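/- Let $K$ be a number field, let $d\ge 2$ and $n\ge 0$ be integers, let $s_1,\dots,s_{d-1},t$ be independent transcendentals over $K$, and put $K_{s,t}=K(s_1,\dots,s_{d-1},t)$. Let $f(x)=x^d+s_1x^{d-1}+\dots+s_{d-1}x+t\in K_{s,t}[x]$ be the generic monic polynomial of degree $d$, let $f'$ be its derivative, and, for $\beta$ in an algebraic closure $\overline{K_{s,t}}$, let $f^{-n}(\beta)$ be the set of all $x\in\overline{K_{s,t}}$ with $f^n(x)=\beta$, where $f^n$ is the $n$-th iterate of $f$. Let $[S_d]^n$ denote the $n$-th iterated wreath product of the symmetric group $S_d$, that is, $[S_d]^0=1$ and $[S_d]^{m+1}=([S_d]^m)^d\rtimes S_d$ with $S_d$ permuting the $d$ factors. Then $K_{s,t}\big(\bigcup_{f'(\beta)=0}f^{-n}(\beta)\big)$ is a Galois extension of the splitting field $K_{s,t}\big((f')^{-1}(0)\big)$ of $f'$, and $$\mathrm{Gal}\Big(K_{s,t}\Big(\bigcup_{f'(\beta)=0}f^{-n}(\beta)\Big)\Big/K_{s,t}\big((f')^{-1}(0)\big)\Big)\;\cong\;\prod_{d-1}[S_d]^n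 ,$$ the product of $d-1$ copies of $[S_d]^n$. -/

import Mathlib

open Polynomial

/-- The monic polynomial `x ^ d + s₁ x ^ (d - 1) + ⋯ + s_{d-1} x + t`; here `s i` is the
coefficient written `s_{i+1}`, since `i` runs through `0, …, d - 2`. -/
noncomputable def monicPoly {F : Type*} [Field F] (d : ℕ) (s : Fin (d - 1) → F) (t : F) : F[X] :=
  X ^ d + ∑ i : Fin (d - 1), C (s i) * X ^ (d - (i.val + 1)) + C t

/-- `(f')⁻¹(0)`: the critical points of `f` in the extension `Ω`. -/
def criticalPoints {F : Type*} (Ω : Type*) [Field F] [Field Ω] [Algebra F Ω] (f : F[X]) : Set Ω :=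
  {β | aeval β (derivative f) = 0}

/-- `f⁻ⁿ(β)`: the points `x` of `Ω` whose `n`-th iterate under `f` is `β`. -/
def iteratedPreimage {F Ω : Type*} [Field F] [Field Ω] [Algebra F Ω] (f : F[X]) (n : ℕ) (β : Ω) :
    Set Ω :=
  {x | (fun y : Ω => aeval y f)^[n] x = β}

/-- The field `F((f')⁻¹(0))` inside `Ω`. -/
noncomputable def criticalField {F : Type*} (Ω : Type*) [Field F] [Field Ω] [Algebra F Ω]
    (f : F[X]) : IntermediateField F Ω :=
  IntermediateField.adjoin F (criticalPoints Ω f)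

/-- The field `F(⋃_{f'(β) = 0} f⁻ⁿ(β))` inside `Ω`. -/
noncomputable def preimageField {F : Type*} (Ω : Type*) [Field F] [Field Ω] [Algebra F Ω]
    (f : F[X]) (n : ℕ) : IntermediateField F Ω :=
  IntermediateField.adjoin F (⋃ β ∈ criticalPoints Ω f, iteratedPreimage f n β)

/-- The `n`-th iterated (permutational) wreath product `[S_d]ⁿ`: the group `[S_d]⁰` is trivial and
`[S_d]ⁿ⁺¹ = ([S_d]ⁿ)ᵈ ⋊ S_d`, where `S_d` permutes the `d` coordinates. -/
noncomputable def iteratedWreath (d : ℕ) : ℕ → GrpCat.{0}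
  | 0 => GrpCat.of PUnit
  | n + 1 => GrpCat.of ((Fin d → iteratedWreath d n) ⋊[mulAutArrow] Equiv.Perm (Fin d))

/-!
The Galois group of the generic polynomial acts on the forest of backward orbits of its `d - 1`
critical points, hence embeds into `∏ [S_d]ⁿ`, and surjectivity is a count of orders: by induction,
the elements fixing level `n` must permute the children of all vertices of level `n` independently.
As the fibres over one level are conjugate, it suffices that some element transposes two siblings
while fixing the rest of level `n + 1`, and that the permutations of one fibre are `2`-transitive.

Each of these facts is inherited from any specialisation with values in `k⟦X⟧`, which can only
shrink the group. Transitivity comes from perturbing degenerate polynomials whose ramification is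
total. The transposition comes from `t = τ + X`, where among all relations
`f ^ (m + 1) (γ i) = γ j` with `m ≤ n` exactly one holds at `t = τ`, and to first order: then
exactly one pair of points in the forest collides at `X = 0`, and its two points are conjugate over
`k⟦X⟧`.
-/

/-! ### Groups acting on regular rooted forests -/

/-- The defining recursion of `iteratedWreath`, stated between types on which the semidirect
product structure is visible. -/
noncomputable def iteratedWreathSucc (d n : ℕ) : iteratedWreath d (n + 1) ≃*
    (Fin d → iteratedWreath d n) ⋊[mulAutArrow] Equiv.Perm (Fin d) :=
  MulEquiv.refl _

theorem card_iteratedWreath (d n : ℕ) :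
    Nat.card (iteratedWreath d n) = d.factorial ^ ∑ i ∈ Finset.range n, d ^ i := by
  induction n with
  | zero => exact (Nat.card_unique (α := PUnit)).trans (by simp)
  | succ n ih =>
    rw [Nat.card_congr ((iteratedWreathSucc d n).toEquiv.trans SemidirectProduct.equivProd),
      Nat.card_prod, Nat.card_fun, Nat.card_perm, ih, Nat.card_fin, geom_sum_succ, pow_succ,
      ← pow_mul, mul_comm d]

instance finite_iteratedWreath (d n : ℕ) : Finite (iteratedWreath d n) :=
  Nat.finite_of_card_ne_zero <| by
    rw [card_iteratedWreath]
    positivity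

/-- A forest in which every vertex has `d` children, with an action of a group `G` by
automorphisms fixing the roots. -/
structure RegularForest (G S ι : Type*) [Group G] [MulAction G S] (d : ℕ) where
  /-- the roots -/
  root : ι → S
  /-- the labelled children of a vertex -/
  child : S → Fin d → S
  root_injective : Function.Injective root
  smul_root : ∀ (g : G) i, g • root i = root i
  child_inj : ∀ {x y i j}, child x i = child y j → x = y ∧ i = j
  exists_smul_child : ∀ (g : G) x i, ∃ j, g • child x i = child (g • x) j

namespace RegularForest

variable {G S ι : Type*} [Group G] [MulAction G S] {d : ℕ} (T : RegularForest G S ι d)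

section Portrait

/-- The permutation of labels by which `g` maps the children of `x` to those of `g • x`. -/
noncomputable def perm (g : G) (x : S) : Equiv.Perm (Fin d) :=
  Equiv.ofBijective (fun i => (T.exists_smul_child g x i).choose) <| by
    refine Finite.injective_iff_bijective.1 fun i j h => ?_
    have hi := (T.exists_smul_child g x i).choose_spec
    have hj := (T.exists_smul_child g x j).choose_spec
    rw [show (T.exists_smul_child g x i).choose = _ from h, ← hj] at hi
    exact (T.child_inj (smul_left_cancel g hi)).2

theorem smul_child (g : G) (x : S) (i : Fin d) :
    g • T.child x i = T.child (g • x) (T.perm g x i) :=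
  (T.exists_smul_child g x i).choose_spec

variable {T} in
theorem smul_eq_of_smul_child_eq {g : G} {x y : S} {i j : Fin d}
    (h : g • T.child x i = T.child y j) : g • x = y := by
  rw [smul_child] at h
  exact (T.child_inj h).1

theorem perm_eq_iff {g : G} {x : S} (hx : g • x = x) {σ : Equiv.Perm (Fin d)} :
    T.perm g x = σ ↔ ∀ i, g • T.child x i = T.child x (σ i) := by
  refine ⟨fun h i => by rw [smul_child, hx, h], fun h => Equiv.ext fun i => ?_⟩
  have hi := h i
  rw [smul_child, hx] at hi
  exact (T.child_inj hi).2

theorem perm_eq_one_iff {g : G} {x : S} (hx : g • x = x) :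
    T.perm g x = 1 ↔ ∀ i, g • T.child x i = T.child x i :=
  T.perm_eq_iff hx

theorem perm_mul (g h : G) (x : S) : T.perm (g * h) x = T.perm g (h • x) * T.perm h x := by
  ext1 i
  have hi := T.smul_child (g * h) x i
  rw [mul_smul, smul_child, smul_child, mul_smul] at hi
  exact (T.child_inj hi).2.symm

/-- The element of the iterated wreath product describing `g` on the first `n` levels below `x`. -/
noncomputable def portrait (g : G) : ∀ n, S → iteratedWreath d n
  | 0, _ => 1
  | n + 1, x => (iteratedWreathSucc d n).symm
      ⟨fun i => portrait g n (T.child x ((T.perm g x)⁻¹ i)), T.perm g x⟩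

theorem portrait_mul (g h : G) (n : ℕ) (x : S) :
    T.portrait (g * h) n x = T.portrait g n (h • x) * T.portrait h n x := by
  induction n generalizing x with
  | zero => exact (mul_one _).symm
  | succ n ih =>
    simp only [portrait]
    rw [← map_mul]
    congr 1
    refine SemidirectProduct.ext (funext fun i => ?_) (T.perm_mul g h x)
    simp only [SemidirectProduct.mul_left, Pi.mul_apply, perm_mul, mul_inv_rev, ih, smul_child,
      ← Equiv.Perm.mul_apply, mul_inv_cancel_left]
    rfl

/-- The action of `G` on the first `n` levels of the forest. -/
noncomputable def portraitHom (n : ℕ) : G →* (ι → iteratedWreath d n) :=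
  MonoidHom.mk' (fun g i => T.portrait g n (T.root i)) fun g h => by
    funext i
    rw [portrait_mul, smul_root, Pi.mul_apply]

/-- The vertices `n` levels below `x`. -/
def descendants (x : S) : ℕ → Set S
  | 0 => {x}
  | n + 1 => {z | ∃ y ∈ descendants x n, ∃ j, T.child y j = z}

theorem mem_descendants_succ {n : ℕ} {x z : S} :
    z ∈ T.descendants x (n + 1) ↔ ∃ i, z ∈ T.descendants (T.child x i) n := by
  induction n generalizing z with
  | zero =>
    refine ⟨?_, fun ⟨i, hi⟩ => ⟨x, rfl, i, hi.symm⟩⟩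
    rintro ⟨_, rfl, i, rfl⟩
    exact ⟨i, rfl⟩
  | succ n ih =>
    constructor
    · rintro ⟨y, hy, j, rfl⟩
      exact (ih.1 hy).imp fun i hi => ⟨y, hi, j, rfl⟩
    · rintro ⟨i, y, hy, j, rfl⟩
      exact ⟨y, ih.2 ⟨i, hy⟩, j, rfl⟩

theorem descendants_nonempty [NeZero d] (x : S) (n : ℕ) : (T.descendants x n).Nonempty := by
  induction n with
  | zero => exact ⟨x, rfl⟩
  | succ n ih => exact ih.elim fun y hy => ⟨T.child y 0, y, hy, 0, rfl⟩

variable {T} in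
theorem smul_eq_self_of_mem_descendants {g : G} {n : ℕ} {x y : S} (hy : y ∈ T.descendants x n)
    (hg : g • y = y) : g • x = x := by
  induction n generalizing y with
  | zero =>
    obtain rfl : y = x := hy
    exact hg
  | succ n ih =>
    obtain ⟨z, hz, j, rfl⟩ := hy
    exact ih hz (smul_eq_of_smul_child_eq hg)

theorem portrait_eq_one_iff [NeZero d] (g : G) (n : ℕ) (x : S) (hx : g • x = x) :
    T.portrait g n x = 1 ↔ ∀ z ∈ T.descendants x n, g • z = z := by
  induction n generalizing x with
  | zero => simp [portrait, descendants, hx]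
  | succ n ih =>
    rw [portrait, MulEquiv.map_eq_one_iff, SemidirectProduct.ext_iff]
    simp only [SemidirectProduct.one_left, SemidirectProduct.one_right, mem_descendants_succ]
    constructor
    · rintro ⟨hl, hr⟩ z ⟨i, hi⟩
      refine (ih _ ((T.perm_eq_one_iff hx).1 hr i)).1 ?_ z hi
      simpa [hr] using congrFun hl i
    · intro h
      have hc (i : Fin d) : g • T.child x i = T.child x i :=
        have ⟨y, hy⟩ := T.descendants_nonempty (T.child x i) n
        smul_eq_self_of_mem_descendants hy (h y ⟨i, hy⟩)
      have hr := (T.perm_eq_one_iff hx).2 hc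
      refine ⟨funext fun i => ?_, hr⟩
      rw [hr]
      exact (ih _ (hc _)).2 fun z hz => h z ⟨_, hz⟩

end Portrait

section Level

/-- The vertices at distance `n` below the root `i`. -/
def level (i : ι) (n : ℕ) : Set S := T.descendants (T.root i) n

theorem mem_ker_portraitHom [NeZero d] (g : G) (n : ℕ) :
    g ∈ (T.portraitHom n).ker ↔ ∀ i, ∀ z ∈ T.level i n, g • z = z := by
  rw [MonoidHom.mem_ker, funext_iff]
  exact forall_congr' fun i => T.portrait_eq_one_iff g n _ (T.smul_root g i)

theorem smul_mem_level {n : ℕ} {i : ι} {x : S} (g : G) (hx : x ∈ T.level i n) :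
    g • x ∈ T.level i n := by
  induction n generalizing x with
  | zero =>
    obtain rfl : x = _ := hx
    exact T.smul_root g i
  | succ n ih =>
    obtain ⟨y, hy, a, rfl⟩ := hx
    exact ⟨_, ih hy, _, (T.smul_child g y a).symm⟩

/-- All vertices at distance `n` from the roots. -/
abbrev Level (n : ℕ) : Type _ := {x : S // ∃ i, x ∈ T.level i n}

/-- Vertices of a level are numbered by their parents and their labels. -/
noncomputable def levelSuccEquiv (n : ℕ) : T.Level n × Fin d ≃ T.Level (n + 1) :=
  Equiv.ofBijective (fun p => ⟨T.child p.1.1 p.2, p.1.2.imp fun _ h => ⟨_, h, _, rfl⟩⟩) <| by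
    constructor
    · rintro ⟨⟨x, hx⟩, a⟩ ⟨⟨y, hy⟩, b⟩ h
      obtain ⟨rfl, rfl⟩ := T.child_inj (Subtype.ext_iff.1 h)
      rfl
    · rintro ⟨_, i, y, hy, a, rfl⟩
      exact ⟨⟨⟨y, i, hy⟩, a⟩, rfl⟩

/-- The roots form level zero. -/
noncomputable def levelZeroEquiv : ι ≃ T.Level 0 :=
  Equiv.ofBijective (fun i => ⟨T.root i, i, rfl⟩) <| by
    constructor
    · exact fun i j h => T.root_injective (Subtype.ext_iff.1 h)
    · rintro ⟨x, i, hx⟩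
      exact ⟨i, Subtype.ext (show x = _ from hx).symm⟩

instance finite_level [Finite ι] (n : ℕ) : Finite (T.Level n) := by
  induction n with
  | zero => exact Finite.of_equiv _ T.levelZeroEquiv
  | succ n ih => exact Finite.of_equiv _ (T.levelSuccEquiv n)

theorem card_level (n : ℕ) : Nat.card (T.Level n) = Nat.card ι * d ^ n := by
  induction n with
  | zero => rw [← Nat.card_congr T.levelZeroEquiv, pow_zero, mul_one]
  | succ n ih =>
    rw [← Nat.card_congr (T.levelSuccEquiv n), Nat.card_prod, ih, Nat.card_fin, pow_succ, mul_assoc]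

variable [NeZero d]

/-- The pointwise stabiliser of level `n` permutes the children of each vertex of that level. -/
noncomputable def levelPermHom (n : ℕ) :
    (T.portraitHom n).ker →* (T.Level n → Equiv.Perm (Fin d)) :=
  MonoidHom.mk' (fun g x => T.perm g.1 x.1) fun g h => by
    funext x
    obtain ⟨i, hx⟩ := x.2
    have hh : h.1 • x.1 = x.1 := (T.mem_ker_portraitHom h.1 n).1 h.2 i _ hx
    simp only [Subgroup.coe_mul, perm_mul, hh, Pi.mul_apply]

theorem ker_levelPermHom (n : ℕ) : (T.levelPermHom n).ker =
    (T.portraitHom (n + 1)).ker.subgroupOf (T.portraitHom n).ker := by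
  ext g
  have hg := (T.mem_ker_portraitHom g.1 n).1 g.2
  rw [Subgroup.mem_subgroupOf, mem_ker_portraitHom, MonoidHom.mem_ker]
  constructor
  · rintro h i _ ⟨y, hy, a, rfl⟩
    exact (T.perm_eq_one_iff (hg i y hy)).1 (congrFun h ⟨y, i, hy⟩) a
  · intro h
    funext ⟨x, i, hx⟩
    exact (T.perm_eq_one_iff (hg i x hx)).2 fun a => h i _ ⟨x, hx, a, rfl⟩

theorem ker_portraitHom_succ_le (n : ℕ) :
    (T.portraitHom (n + 1)).ker ≤ (T.portraitHom n).ker := by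
  intro g hg
  rw [mem_ker_portraitHom] at hg ⊢
  exact fun i z hz => smul_eq_of_smul_child_eq (hg i _ ⟨z, hz, 0, rfl⟩)

theorem index_ker_portraitHom_zero : (T.portraitHom 0).ker.index = 1 := by
  rw [Subgroup.index_eq_one, eq_top_iff]
  rintro g -
  rw [mem_ker_portraitHom]
  rintro i z (rfl : z = _)
  exact T.smul_root g i

variable [Finite ι]

theorem index_ker_portraitHom_succ {n : ℕ} (h : Function.Surjective (T.levelPermHom n)) :
    (T.portraitHom (n + 1)).ker.index =
      d.factorial ^ (Nat.card ι * d ^ n) * (T.portraitHom n).ker.index := by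
  rw [← Subgroup.relIndex_mul_index (T.ker_portraitHom_succ_le n), Subgroup.relIndex,
    ← ker_levelPermHom, Subgroup.index_ker, MonoidHom.range_eq_top.2 h, Subgroup.card_top,
    Nat.card_fun, Nat.card_perm, Nat.card_fin, card_level]

theorem portraitHom_surjective_of_levelPermHom
    (h : ∀ n, Function.Surjective (T.levelPermHom n)) (n : ℕ) :
    Function.Surjective (T.portraitHom n) := by
  have index (n : ℕ) : (T.portraitHom n).ker.index =
      (d.factorial ^ ∑ i ∈ Finset.range n, d ^ i) ^ Nat.card ι := by
    induction n with
    | zero => simp [index_ker_portraitHom_zero]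
    | succ n ih =>
      rw [T.index_ker_portraitHom_succ (h n), ih, Finset.sum_range_succ, pow_add, mul_pow,
        mul_comm (Nat.card ι), pow_mul, mul_comm]
  rw [← MonoidHom.range_eq_top]
  refine Subgroup.eq_top_of_card_eq _ ?_
  rw [← Subgroup.index_ker, index, Nat.card_fun, card_iteratedWreath]

end Level

section Generation

/-- The element `g` exchanges the children `a` and `b` of `x` and fixes every other vertex of
level `n + 1`; here `n` is the level of `x`. -/
structure SwapsSiblings (n : ℕ) (x : S) (a b : Fin d) (g : G) : Prop where
  smul_left : g • T.child x a = T.child x b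
  smul_right : g • T.child x b = T.child x a
  smul_of_ne : ∀ i, ∀ z ∈ T.level i (n + 1), z ≠ T.child x a → z ≠ T.child x b → g • z = z

/-- Some element of `G` induces on level `n + 1` a transposition of two siblings. -/
def HasSiblingSwap (n : ℕ) (i : ι) : Prop :=
  ∃ x ∈ T.level i n, ∃ a b, a ≠ b ∧ ∃ g : G, T.SwapsSiblings n x a b g

/-- The group `G` is transitive on the children of some vertex of level `n`. -/
def ChildrenTransitive (n : ℕ) (i : ι) : Prop :=
  ∃ x ∈ T.level i n, ∀ a b, ∃ g : G, g • T.child x a = T.child x b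

/-- The stabiliser of some vertex of level `n + 1` is transitive on its siblings. -/
def SiblingsTransitive (n : ℕ) (i : ι) : Prop :=
  ∃ x ∈ T.level i n, ∃ c, ∀ a b, a ≠ c → b ≠ c → ∃ g : G, g • T.child x c = T.child x c ∧
    g • T.child x a = T.child x b

variable {T}

theorem siblingsTransitive_of_le_two [NeZero d] (hd : d ≤ 2) {i : ι} {n : ℕ} {x : S}
    (hx : x ∈ T.level i n) : T.SiblingsTransitive n i := by
  refine ⟨x, hx, 0, fun a b ha hb => ⟨1, one_smul _ _, ?_⟩⟩
  obtain rfl : a = b := by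
    rw [← Fin.val_ne_zero_iff] at ha hb
    omega
  exact one_smul _ _

theorem exists_smul_eq_of_mem_level {i : ι} (h : ∀ n, T.ChildrenTransitive n i) {n : ℕ} {x y : S}
    (hx : x ∈ T.level i n) (hy : y ∈ T.level i n) : ∃ g : G, g • x = y := by
  induction n generalizing x y with
  | zero =>
    obtain rfl : x = _ := hx
    obtain rfl : y = _ := hy
    exact ⟨1, one_smul _ _⟩
  | succ n ih =>
    obtain ⟨x, hx, a, rfl⟩ := hx
    obtain ⟨y, hy, b, rfl⟩ := hy
    obtain ⟨z, hz, hzt⟩ := h n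
    obtain ⟨g, rfl⟩ := ih hx hz
    obtain ⟨k, hk⟩ := ih hy hz
    obtain ⟨l, hl⟩ := hzt (T.perm g x a) (T.perm k y b)
    refine ⟨k⁻¹ * l * g, ?_⟩
    rw [mul_smul, smul_child, mul_smul, hl, ← hk, ← smul_child, inv_smul_smul]

theorem exists_smul_pair {i : ι} (h : ∀ n, T.ChildrenTransitive n i)
    {n : ℕ} (h' : T.SiblingsTransitive n i) {x y : S} (hx : x ∈ T.level i n)
    (hy : y ∈ T.level i n) {a b a' b' : Fin d} (hab : a ≠ b) (hab' : a' ≠ b') :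
    ∃ g : G, g • T.child x a = T.child y a' ∧ g • T.child x b = T.child y b' := by
  obtain ⟨z, hz, c, hc⟩ := h'
  have normalise {x : S} {a b : Fin d} (hx : x ∈ T.level i n) (hab : a ≠ b) :
      ∃ g : G, ∃ e, e ≠ c ∧ g • T.child x a = T.child z c ∧ g • T.child x b = T.child z e := by
    obtain ⟨g, hg⟩ := exists_smul_eq_of_mem_level h (n := n + 1) (x := T.child x a)
      (y := T.child z c) ⟨x, hx, a, rfl⟩ ⟨z, hz, c, rfl⟩
    obtain rfl := smul_eq_of_smul_child_eq hg
    refine ⟨g, T.perm g x b, ?_, hg, T.smul_child g x b⟩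
    rw [smul_child] at hg
    rw [← (T.child_inj hg).2]
    exact (T.perm g x).injective.ne hab.symm
  obtain ⟨g, e, he, hga, hgb⟩ := normalise hx hab
  obtain ⟨k, f, hf, hka, hkb⟩ := normalise hy hab'
  obtain ⟨l, hlc, hle⟩ := hc e f he hf
  refine ⟨k⁻¹ * l * g, ?_, ?_⟩
  · rw [mul_smul, hga, mul_smul, hlc, ← hka, inv_smul_smul]
  · rw [mul_smul, hgb, mul_smul, hle, ← hkb, inv_smul_smul]

namespace SwapsSiblings

variable {n : ℕ} {x : S} {a b : Fin d} {g : G}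

theorem conj (hg : T.SwapsSiblings n x a b g) {k : G} {y : S} {a' b' : Fin d}
    (hka : k • T.child x a = T.child y a') (hkb : k • T.child x b = T.child y b') :
    T.SwapsSiblings n y a' b' (k * g * k⁻¹) where
  smul_left := by rw [← hka, ← hkb, mul_smul, inv_smul_smul, mul_smul, hg.smul_left]
  smul_right := by rw [← hka, ← hkb, mul_smul, inv_smul_smul, mul_smul, hg.smul_right]
  smul_of_ne i z hz ha hb := by
    rw [mul_smul, mul_smul, hg.smul_of_ne i _ (T.smul_mem_level k⁻¹ hz), smul_inv_smul]
    · rwa [ne_eq, inv_smul_eq_iff, hka]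
    · rwa [ne_eq, inv_smul_eq_iff, hkb]

theorem smul_child_eq (hg : T.SwapsSiblings n x a b g) {i : ι} {z : S} (hz : z ∈ T.level i n)
    (hzx : z ≠ x) (c : Fin d) : g • T.child z c = T.child z c :=
  hg.smul_of_ne i _ ⟨z, hz, c, rfl⟩ (fun e => hzx (T.child_inj e).1)
    fun e => hzx (T.child_inj e).1

theorem smul_child_swap (hg : T.SwapsSiblings n x a b g) {i : ι} (hx : x ∈ T.level i n)
    (c : Fin d) : g • T.child x c = T.child x (Equiv.swap a b c) := by
  by_cases hca : c = a
  · rw [hca, hg.smul_left, Equiv.swap_apply_left]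
  by_cases hcb : c = b
  · rw [hcb, hg.smul_right, Equiv.swap_apply_right]
  rw [Equiv.swap_apply_of_ne_of_ne hca hcb]
  exact hg.smul_of_ne i _ ⟨x, hx, c, rfl⟩ (fun e => hca (T.child_inj e).2)
    fun e => hcb (T.child_inj e).2

variable [NeZero d]

theorem smul_eq_self (hg : T.SwapsSiblings n x a b g) {i : ι} {z : S} (hz : z ∈ T.level i n) :
    g • z = z := by
  by_cases hzx : z = x
  · rw [hzx]
    exact smul_eq_of_smul_child_eq hg.smul_left
  · exact smul_eq_of_smul_child_eq (hg.smul_child_eq hz hzx 0)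

theorem mulSingle_mem_range [DecidableEq (T.Level n)] (hg : T.SwapsSiblings n x a b g)
    (hx : ∃ i, x ∈ T.level i n) :
    Pi.mulSingle (⟨x, hx⟩ : T.Level n) (Equiv.swap a b) ∈ (T.levelPermHom n).range := by
  have hker : g ∈ (T.portraitHom n).ker :=
    (T.mem_ker_portraitHom g n).2 fun _ _ hz => hg.smul_eq_self hz
  refine ⟨⟨g, hker⟩, ?_⟩
  funext ⟨z, i, hz⟩
  refine (T.perm_eq_iff (hg.smul_eq_self hz)).2 fun c => ?_
  by_cases hzx : z = x
  · subst hzx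
    rw [Pi.mulSingle_eq_same, hg.smul_child_swap hz]
  · rw [Pi.mulSingle_eq_of_ne (fun e => hzx (Subtype.ext_iff.1 e)), hg.smul_child_eq hz hzx]
    rfl

end SwapsSiblings

variable [NeZero d] [Finite ι]

theorem levelPermHom_surjective (h : ∀ n i, T.ChildrenTransitive n i)
    {n : ℕ} (h' : ∀ i, T.SiblingsTransitive n i) (h'' : ∀ i, T.HasSiblingSwap n i) :
    Function.Surjective (T.levelPermHom n) := by
  classical
  have swap_mem (x : T.Level n) {a b : Fin d} (hab : a ≠ b) :
      Pi.mulSingle x (Equiv.swap a b) ∈ (T.levelPermHom n).range := by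
    obtain ⟨x, i, hx⟩ := x
    obtain ⟨y, hy, a', b', hab', g, hg⟩ := h'' i
    obtain ⟨k, hka, hkb⟩ := exists_smul_pair (fun n => h n i) (h' i) hy hx hab' hab
    exact (hg.conj hka hkb).mulSingle_mem_range ⟨i, hx⟩
  rw [← MonoidHom.range_eq_top, eq_top_iff]
  rintro p -
  refine Submonoid.pi_mem_of_mulSingle_mem p fun x => ?_
  have hle : (⊤ : Subgroup (Equiv.Perm (Fin d))) ≤ (T.levelPermHom n).range.comap
      (MonoidHom.mulSingle (fun _ : T.Level n => Equiv.Perm (Fin d)) x) := by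
    rw [← Equiv.Perm.closure_isSwap, Subgroup.closure_le]
    rintro _ ⟨a, b, hab, rfl⟩
    exact swap_mem x hab
  exact hle (Subgroup.mem_top (p x))

theorem portraitHom_surjective (h : ∀ n i, T.ChildrenTransitive n i)
    (h' : ∀ n i, T.SiblingsTransitive n i) (h'' : ∀ n i, T.HasSiblingSwap n i) (n : ℕ) :
    Function.Surjective (T.portraitHom n) :=
  T.portraitHom_surjective_of_levelPermHom (fun n => levelPermHom_surjective h (h' n) (h'' n)) n

end Generation

end RegularForest

/-! ### The monic polynomial with prescribed critical points -/

section CritPoly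

variable {R R' : Type*} [CommRing R] [Algebra ℚ R] [CommRing R'] [Algebra ℚ R'] {r : ℕ}

/-- The monic polynomial of degree `r + 1` without constant term whose critical points are the
`γ j`: the termwise primitive of `(r + 1) ∏ (X - γ j)`. -/
noncomputable def critPoly (γ : Fin r → R) : R[X] :=
  ∑ k ∈ Finset.range (r + 1),
    C (algebraMap ℚ R ((r + 1) / (k + 1)) * (∏ j, (X - C (γ j))).coeff k) * X ^ (k + 1)

theorem map_critPoly (φ : R →+* R') (γ : Fin r → R) :
    (critPoly γ).map φ = critPoly (φ ∘ γ) := by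
  have h : (∏ j, (X - C (γ j))).map φ = ∏ j, (X - C ((φ ∘ γ) j)) := by
    simp [Polynomial.map_prod]
  simp only [critPoly, Polynomial.map_sum, Polynomial.map_mul, map_C, Polynomial.map_pow, map_X,
    ← h, coeff_map]
  exact Finset.sum_congr rfl fun k _ => by rw [map_mul, RingHom.map_rat_algebraMap]

theorem eval_zero_critPoly (γ : Fin r → R) : (critPoly γ).eval 0 = 0 := by
  simp only [critPoly, eval_finsetSum, eval_mul, eval_pow, eval_X]
  exact Finset.sum_eq_zero fun k _ => by rw [zero_pow k.succ_ne_zero, mul_zero]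

theorem derivative_critPoly (γ : Fin r → R) :
    derivative (critPoly γ) = C ((r : R) + 1) * ∏ j, (X - C (γ j)) := by
  nontriviality R
  have coeff_mul (k : ℕ) : algebraMap ℚ R ((r + 1) / (k + 1)) * ((k + 1 : ℕ) : R) = r + 1 := by
    rw [← map_natCast (algebraMap ℚ R), ← map_mul, Nat.cast_add_one,
      div_mul_cancel₀ _ (by positivity)]
    simp
  conv_rhs => rw [as_sum_range_C_mul_X_pow (∏ j, (X - C (γ j))),
    natDegree_finsetProd_X_sub_C_eq_card, Finset.card_univ, Fintype.card_fin, Finset.mul_sum]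
  simp only [critPoly, derivative_sum, derivative_C_mul_X_pow, Nat.add_sub_cancel, ← mul_assoc,
    ← C_mul]
  exact Finset.sum_congr rfl fun k _ => by rw [mul_right_comm, coeff_mul]

theorem natDegree_critPoly_le (γ : Fin r → R) : (critPoly γ).natDegree ≤ r + 1 := by
  refine natDegree_sum_le_of_forall_le _ _ fun k hk => ?_
  exact (natDegree_C_mul_X_pow_le _ _).trans (Finset.mem_range.1 hk)

theorem coeff_critPoly_succ (γ : Fin r → R) : (critPoly γ).coeff (r + 1) = 1 := by
  nontriviality R
  have hlead : (∏ j, (X - C (γ j))).coeff r = 1 := by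
    simpa [Monic, leadingCoeff] using monic_prod_X_sub_C γ Finset.univ
  simp only [critPoly, finsetSum_coeff, coeff_C_mul_X_pow, add_left_inj]
  rw [Finset.sum_ite_eq, if_pos (Finset.self_mem_range_succ r), hlead, div_self (by positivity),
    map_one, mul_one]

theorem monic_critPoly (γ : Fin r → R) : (critPoly γ).Monic :=
  monic_of_natDegree_le_of_coeff_eq_one _ (natDegree_critPoly_le γ) (coeff_critPoly_succ γ)

theorem natDegree_critPoly [Nontrivial R] (γ : Fin r → R) : (critPoly γ).natDegree = r + 1 :=
  natDegree_eq_of_le_of_coeff_ne_zero (natDegree_critPoly_le γ) <| by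
    rw [coeff_critPoly_succ]
    exact one_ne_zero

theorem eq_of_derivative_eq_of_coeff_zero_eq {p q : R[X]} (h : derivative p = derivative q)
    (h0 : p.coeff 0 = q.coeff 0) : p = q := by
  ext n
  cases n with
  | zero => exact h0
  | succ n =>
    have hn := congrArg (fun f => coeff f n) h
    simp only [coeff_derivative] at hn
    have hu : IsUnit ((n : R) + 1) := by
      have hcast : (n : R) + 1 = algebraMap ℚ R (n + 1) := by simp
      rw [hcast]
      exact (IsUnit.mk0 _ (by positivity)).map _
    exact hu.mul_right_cancel hn

theorem critPoly_update_zero (i : Fin r) (a : R) :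
    critPoly (Function.update (0 : Fin r → R) i (r * a)) =
      X ^ (r + 1) - C ((r + 1) * a) * X ^ r := by
  obtain ⟨m, rfl⟩ : ∃ m, r = m + 1 := ⟨r - 1, by have := i.pos; omega⟩
  refine eq_of_derivative_eq_of_coeff_zero_eq ?_ ?_
  · have hprod : ∏ j, (X - C (Function.update (0 : Fin (m + 1) → R) i ((m + 1 : ℕ) * a) j)) =
        (X - C ((m + 1 : ℕ) * a)) * X ^ m := by
      rw [Fin.prod_univ_succAbove _ i]
      simp
    rw [derivative_critPoly, hprod]
    simp only [derivative_sub, derivative_X_pow, derivative_C_mul_X_pow, Nat.add_sub_cancel]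
    push_cast
    simp only [C_mul, C_add, C_1, map_natCast]
    ring
  · rw [coeff_zero_eq_eval_zero, eval_zero_critPoly]
    simp [coeff_zero_eq_eval_zero]

theorem critPoly_zero : critPoly (0 : Fin r → R) = X ^ (r + 1) := by
  refine eq_of_derivative_eq_of_coeff_zero_eq ?_ ?_
  · rw [derivative_critPoly]
    simp
  · rw [coeff_zero_eq_eval_zero, eval_zero_critPoly]
    simp

theorem eval_derivative_critPoly_self (γ : Fin r → R) (i : Fin r) :
    (derivative (critPoly γ)).eval (γ i) = 0 := by
  rw [derivative_critPoly, eval_mul, eval_prod, Finset.prod_eq_zero (Finset.mem_univ i) (by simp),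
    mul_zero]

theorem X_sq_dvd_critPoly {γ : Fin r → R} {i : Fin r} (hi : γ i = 0) :
    X ^ 2 ∣ critPoly γ := by
  rw [X_pow_dvd_iff]
  intro n hn
  interval_cases n
  · rw [coeff_zero_eq_eval_zero, eval_zero_critPoly]
  · have hder := eval_derivative_critPoly_self γ i
    rw [hi, ← coeff_zero_eq_eval_zero, coeff_derivative] at hder
    simpa using hder

/-- The `n`-th iterate of `x ↦ critPoly γ x + t`. -/
noncomputable def critIter (γ : Fin r → R) (t : R) (n : ℕ) (x : R) : R :=
  (fun y => (critPoly γ).eval y + t)^[n] x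

@[simp]
theorem critIter_zero (γ : Fin r → R) (t x : R) : critIter γ t 0 x = x := rfl

theorem critIter_succ (γ : Fin r → R) (t : R) (n : ℕ) (x : R) :
    critIter γ t (n + 1) x = critIter γ t n ((critPoly γ).eval x + t) := rfl

theorem critIter_succ' (γ : Fin r → R) (t : R) (n : ℕ) (x : R) :
    critIter γ t (n + 1) x = (critPoly γ).eval (critIter γ t n x) + t :=
  Function.iterate_succ_apply' _ _ _

theorem critIter_add (γ : Fin r → R) (t : R) (m n : ℕ) (x : R) :
    critIter γ t (m + n) x = critIter γ t m (critIter γ t n x) :=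
  Function.iterate_add_apply _ _ _ _

theorem map_eval_critPoly (φ : R →+* R') (γ : Fin r → R) (x : R) :
    φ ((critPoly γ).eval x) = (critPoly (φ ∘ γ)).eval (φ x) := by
  rw [← map_critPoly, eval_map, eval₂_hom]

theorem map_critIter (φ : R →+* R') (γ : Fin r → R) (t : R) (n : ℕ) (x : R) :
    φ (critIter γ t n x) = critIter (φ ∘ γ) (φ t) n (φ x) := by
  induction n with
  | zero => rfl
  | succ n ih => rw [critIter_succ', critIter_succ', map_add, map_eval_critPoly, ih]

theorem eval_critIter (γ : Fin r → R) (t : R) (n : ℕ) (p : R[X]) :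
    (critIter (C ∘ γ) X n p).eval t = critIter γ t n (p.eval t) := by
  simpa [Function.comp_def] using map_critIter (evalRingHom t) (C ∘ γ) X n p

theorem polynomial_map_critIter (φ : R →+* R') (γ : Fin r → R) (n : ℕ) (p : R[X]) :
    (critIter (C ∘ γ) X n p).map φ = critIter (C ∘ φ ∘ γ) X n (p.map φ) := by
  simpa [Function.comp_def] using map_critIter (mapRingHom φ) (C ∘ γ) X n p

theorem eval_critPoly_C_comp (γ : Fin r → R) (p : R[X]) :
    (critPoly (C ∘ γ)).eval p = (critPoly γ).comp p := by
  rw [← map_critPoly, eval_map, comp]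

theorem monic_critIter_and_natDegree [Nontrivial R] (hr : 1 ≤ r) (γ : Fin r → R) {p : R[X]}
    (hp : p.Monic) (hp' : p.natDegree = 1) (n : ℕ) :
    (critIter (C ∘ γ) X n p).Monic ∧ (critIter (C ∘ γ) X n p).natDegree = (r + 1) ^ n := by
  induction n with
  | zero => exact ⟨hp, hp'⟩
  | succ n ih =>
    rw [critIter_succ', eval_critPoly_C_comp]
    have hq : ((critPoly γ).comp (critIter (C ∘ γ) X n p)).Monic :=
      (monic_critPoly γ).comp ih.1 (by rw [ih.2]; positivity)
    have hd : ((critPoly γ).comp (critIter (C ∘ γ) X n p)).natDegree = (r + 1) ^ (n + 1) := by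
      rw [natDegree_comp_eq_of_mul_ne_zero, natDegree_critPoly, ih.2, pow_succ']
      rw [(monic_critPoly γ).leadingCoeff, ih.1.leadingCoeff]
      simp
    have hlt : (X : R[X]).natDegree <
        ((critPoly γ).comp (critIter (C ∘ γ) X n p)).natDegree := by
      rw [hd, natDegree_X]
      exact Nat.one_lt_pow (by omega) (by omega)
    exact ⟨hq.add_of_left (degree_lt_degree hlt), by
      rw [natDegree_add_eq_left_of_natDegree_lt hlt, hd]⟩

/-- The relation `f_T ^ (n + 1) (a) = b` as a polynomial in the variable `T`, where
`f_T = critPoly γ + T`. -/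
noncomputable def relPoly (γ : Fin r → R) (n : ℕ) (a b : R) : R[X] :=
  critIter (C ∘ γ) X (n + 1) (C a) - C b

theorem eval_relPoly (γ : Fin r → R) (n : ℕ) (a b t : R) :
    (relPoly γ n a b).eval t = critIter γ t (n + 1) a - b := by
  rw [relPoly, eval_sub, eval_critIter, eval_C, eval_C]

theorem map_relPoly (φ : R →+* R') (γ : Fin r → R) (n : ℕ) (a b : R) :
    (relPoly γ n a b).map φ = relPoly (φ ∘ γ) n (φ a) (φ b) := by
  rw [relPoly, Polynomial.map_sub, polynomial_map_critIter, map_C, map_C, relPoly]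

theorem monic_relPoly_and_natDegree [Nontrivial R] (hr : 1 ≤ r) (γ : Fin r → R) (n : ℕ) (a b : R) :
    (relPoly γ n a b).Monic ∧ (relPoly γ n a b).natDegree = (r + 1) ^ n := by
  have hfirst : (critPoly (C ∘ γ)).eval (C a) + X = X + C ((critPoly γ).eval a) := by
    rw [eval_critPoly_C_comp, comp_C, add_comm]
  have h := monic_critIter_and_natDegree hr γ (monic_X_add_C ((critPoly γ).eval a))
    (natDegree_X_add_C _) n
  rw [← hfirst, ← critIter_succ] at h
  have hlt : (C b).natDegree < (critIter (C ∘ γ) X (n + 1) (C a)).natDegree := by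
    rw [natDegree_C, h.2]
    positivity
  exact ⟨h.1.sub_of_left (degree_lt_degree hlt), by
    rw [relPoly, natDegree_sub_eq_left_of_natDegree_lt hlt, h.2]⟩

theorem monic_relPoly [Nontrivial R] (hr : 1 ≤ r) (γ : Fin r → R) (n : ℕ) (a b : R) :
    (relPoly γ n a b).Monic :=
  (monic_relPoly_and_natDegree hr γ n a b).1

theorem natDegree_relPoly [Nontrivial R] (hr : 1 ≤ r) (γ : Fin r → R) (n : ℕ) (a b : R) :
    (relPoly γ n a b).natDegree = (r + 1) ^ n :=
  (monic_relPoly_and_natDegree hr γ n a b).2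

/-- The polynomial whose roots are the preimages of `y` under `x ↦ critPoly γ x + t`. -/
noncomputable def fibrePoly (γ : Fin r → R) (t y : R) : R[X] :=
  critPoly γ + C (t - y)

theorem eval_fibrePoly_eq_zero {γ : Fin r → R} {t y x : R} :
    (fibrePoly γ t y).eval x = 0 ↔ (critPoly γ).eval x + t = y := by
  rw [fibrePoly, eval_add, eval_C, ← add_sub_assoc, sub_eq_zero]

theorem map_fibrePoly (φ : R →+* R') (γ : Fin r → R) (t y : R) :
    (fibrePoly γ t y).map φ = fibrePoly (φ ∘ γ) (φ t) (φ y) := by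
  rw [fibrePoly, Polynomial.map_add, map_critPoly, map_C, map_sub, fibrePoly]

theorem aeval_fibrePoly_eq_zero [Algebra R R'] {γ : Fin r → R} {t y : R} {x : R'} :
    aeval x (fibrePoly γ t y) = 0 ↔
      (critPoly (algebraMap R R' ∘ γ)).eval x + algebraMap R R' t = algebraMap R R' y := by
  rw [aeval_def, ← eval_map, map_fibrePoly, eval_fibrePoly_eq_zero]

theorem monic_fibrePoly (γ : Fin r → R) (t y : R) : (fibrePoly γ t y).Monic := by
  nontriviality R
  refine (monic_critPoly γ).add_of_left (degree_lt_degree ?_)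
  rw [natDegree_C, natDegree_critPoly]
  exact r.succ_pos

theorem natDegree_fibrePoly [Nontrivial R] (γ : Fin r → R) (t y : R) :
    (fibrePoly γ t y).natDegree = r + 1 := by
  rw [fibrePoly, natDegree_add_C, natDegree_critPoly]

theorem derivative_fibrePoly (γ : Fin r → R) (t y : R) :
    derivative (fibrePoly γ t y) = derivative (critPoly γ) := by
  rw [fibrePoly, derivative_add, derivative_C, add_zero]

end CritPoly

section FibreOverField

variable {F : Type*} [Field F] [Algebra ℚ F] {r : ℕ} {γ : Fin r → F}

theorem exists_eq_of_eval_derivative_critPoly {a : F}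
    (h : (derivative (critPoly γ)).eval a = 0) : ∃ i, a = γ i := by
  have : CharZero F := algebraRat.charZero F
  rw [derivative_critPoly, eval_mul, eval_C, eval_prod, mul_eq_zero, Finset.prod_eq_zero_iff] at h
  rcases h with h | ⟨i, -, h⟩
  · exact absurd h (by exact_mod_cast r.succ_ne_zero)
  · exact ⟨i, by simpa [sub_eq_zero] using h⟩

theorem eval_ne_zero_of_fibrePoly_eq_sq_mul {j : Fin r} (hj : ∀ i, γ i = γ j → i = j) {t y : F}
    {h : F[X]} (hh : fibrePoly γ t y = (X - C (γ j)) ^ 2 * h) : h.eval (γ j) ≠ 0 := by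
  have : CharZero F := algebraRat.charZero F
  have hder : 2 * h + (X - C (γ j)) * derivative h =
      C (r + 1 : F) * ∏ i ∈ Finset.univ.erase j, (X - C (γ i)) := by
    have hder' := derivative_fibrePoly γ t y
    rw [hh, derivative_critPoly, ← Finset.mul_prod_erase _ _ (Finset.mem_univ j)] at hder'
    refine mul_left_cancel₀ (X_sub_C_ne_zero (γ j)) ?_
    rw [mul_left_comm, ← hder', derivative_mul, derivative_X_sub_C_sq]
    simp only [map_ofNat]
    ring
  intro h0
  have hev := congrArg (eval (γ j)) hder
  rw [eval_add, eval_mul, h0, eval_mul, eval_sub, eval_X, eval_C, sub_self, zero_mul, mul_zero,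
    add_zero, eval_mul, eval_C, eval_prod, eq_comm, mul_eq_zero, Finset.prod_eq_zero_iff] at hev
  rcases hev with hr | ⟨i, hi, hij⟩
  · exact absurd hr (by exact_mod_cast r.succ_ne_zero)
  · rw [eval_sub, eval_X, eval_C, sub_eq_zero] at hij
    exact Finset.ne_of_mem_erase hi (hj i hij.symm)

variable [IsAlgClosed F]

theorem separable_fibrePoly {t y : F} (h : ∀ i, (critPoly γ).eval (γ i) + t ≠ y) :
    (fibrePoly γ t y).Separable := by
  refine (isCoprime_iff_aeval_ne_zero_of_isAlgClosed F F _ _).2 fun a => ?_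
  simp only [coe_aeval_eq_eval, derivative_fibrePoly]
  by_contra! ⟨ha, ha'⟩
  obtain ⟨i, rfl⟩ := exists_eq_of_eval_derivative_critPoly ha'
  exact h i (eval_fibrePoly_eq_zero.1 ha)

theorem exists_fibrePoly_eq_sq_mul {j : Fin r}
    (hj : ∀ i, (critPoly γ).eval (γ i) = (critPoly γ).eval (γ j) → i = j) (t : F) :
    ∃ h : F[X], fibrePoly γ t ((critPoly γ).eval (γ j) + t) = (X - C (γ j)) ^ 2 * h ∧
      h.eval (γ j) ≠ 0 ∧ h.Separable := by
  set p := fibrePoly γ t ((critPoly γ).eval (γ j) + t)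
  obtain ⟨h, hph⟩ : (X - C (γ j)) ^ 2 ∣ p := by
    rw [← le_rootMultiplicity_iff (monic_fibrePoly ..).ne_zero, Nat.succ_le_iff,
      one_lt_rootMultiplicity_iff_isRoot (monic_fibrePoly ..).ne_zero, derivative_fibrePoly]
    exact ⟨eval_fibrePoly_eq_zero.2 rfl, eval_derivative_critPoly_self γ j⟩
  have hhj : h.eval (γ j) ≠ 0 :=
    eval_ne_zero_of_fibrePoly_eq_sq_mul (fun i hi => hj i (by rw [hi])) hph
  refine ⟨h, hph, hhj, (isCoprime_iff_aeval_ne_zero_of_isAlgClosed F F _ _).2 fun a => ?_⟩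
  simp only [coe_aeval_eq_eval]
  by_contra! ⟨ha, ha'⟩
  have hpa : p.eval a = 0 := by rw [hph, eval_mul, ha, mul_zero]
  have hpa' : (derivative p).eval a = 0 := by
    rw [hph, derivative_mul, eval_add, eval_mul, eval_mul, ha, ha', mul_zero, mul_zero, add_zero]
  rw [derivative_fibrePoly] at hpa'
  obtain ⟨i, rfl⟩ := exists_eq_of_eval_derivative_critPoly hpa'
  obtain rfl := hj i (add_right_cancel (eval_fibrePoly_eq_zero.1 hpa))
  exact hhj ha

end FibreOverField

/-! ### Specialisation and algebraic independence -/

theorem isCoprime_map_of_isCoprime_map {A k₁ k₂ : Type*} [CommRing A] [Field k₁] [Field k₂]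
    {P Q : A[X]} (hP : P.Monic) (φ : A →+* k₁) (θ : A →+* k₂) (hθ : Function.Injective θ)
    (h : IsCoprime (P.map φ) (Q.map φ)) : IsCoprime (P.map θ) (Q.map θ) := by
  have hunit : IsUnit (resultant (P.map φ) (Q.map φ) (P.map φ).natDegree Q.natDegree) := by
    have hcop := (isUnit_resultant_iff_isCoprime (hP.map φ)).2 h
    have hdeg := resultant_add_right_deg (f := P.map φ) (g := Q.map φ) (m := (P.map φ).natDegree)
      (n := (Q.map φ).natDegree) (Q.natDegree - (Q.map φ).natDegree) le_rfl
    rw [Nat.add_sub_cancel' natDegree_map_le, coeff_natDegree, (hP.map φ).leadingCoeff] at hdeg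
    rw [hdeg]
    simpa using hcop
  rw [hP.natDegree_map, resultant_map_map] at hunit
  have hres : resultant P Q ≠ 0 := by
    intro h0
    rw [h0, map_zero] at hunit
    exact not_isUnit_zero hunit
  rw [← isUnit_resultant_iff_isCoprime (hP.map θ), isUnit_iff_ne_zero, hP.natDegree_map,
    natDegree_map_eq_of_injective hθ, resultant_map_map]
  exact (map_ne_zero_iff θ hθ).2 hres

open scoped IntermediateField.algebraAdjoinAdjoin in
theorem algebraicIndependent_of_isAlgebraic_adjoin {K L ι : Type*} [Field K] [Field L] [Algebra K L]
    [Finite ι] {x y : ι → L} (hy : AlgebraicIndependent K y)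
    (h : ∀ i, IsAlgebraic (IntermediateField.adjoin K (Set.range x)) (y i)) :
    AlgebraicIndependent K x := by
  have hsub : Set.range y ⊆ (AlgebraicIndependent.matroid K L).closure (Set.range x) := by
    rintro _ ⟨i, rfl⟩
    rw [AlgebraicIndependent.matroid_closure_eq, SetLike.mem_coe, Subalgebra.mem_algebraicClosure]
    exact (IsFractionRing.isAlgebraic_iff _ (IntermediateField.adjoin K (Set.range x)) _).2 (h i)
  have hle : (Set.range y).encard ≤ (AlgebraicIndependent.matroid K L).eRk (Set.range x) := by
    rw [← Matroid.eRk_closure_eq]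
    exact (AlgebraicIndependent.matroid_indep_iff.2
      hy.to_subtype_range).encard_le_eRk_of_subset hsub
  have hcard : (Set.range y).encard = ENat.card ι := by
    rw [← Set.image_univ, hy.injective.encard_image, Set.encard_univ]
  have hx : (Set.range x).encard ≤ ENat.card ι := by
    rw [← Set.image_univ, ← Set.encard_univ]
    exact Set.encard_image_le _ _
  obtain ⟨I, hI⟩ := (AlgebraicIndependent.matroid K L).exists_isBasis (Set.range x)
  rw [hcard, hI.eRk_eq_encard] at hle
  have hfin := Set.finite_range x
  have hIx : I = Set.range x :=
    (hfin.subset hI.subset).eq_of_subset_of_encard_le hI.subset (hx.trans hle)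
  rw [hIx] at hle
  rw [hIx] at hI
  refine AlgebraicIndependent.of_subtype_range ?_ hI.indep
  have hc : Nat.card ι ≤ Nat.card (Set.range x) := by
    rw [ENat.card_eq_coe_natCard, ← hfin.cast_ncard_eq] at hle
    exact_mod_cast hle
  have hbij := Set.rangeFactorization_surjective (f := x) |>.bijective_of_nat_card_le hc
  exact fun a b hab => hbij.1 (Subtype.ext hab)

theorem exists_algHom_of_algebraicIndependent {K B M ι : Type*} [Field K] [Field B] [Field M]
    [Algebra K B] [Algebra K M] {x : ι → B} {y : ι → M} (hx : AlgebraicIndependent K x)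
    (hgen : IntermediateField.adjoin K (Set.range x) = ⊤) (hy : AlgebraicIndependent K y) :
    ∃ ψ : B →ₐ[K] M, ∀ i, ψ (x i) = y i := by
  let e := (IntermediateField.equivOfEq hgen).trans IntermediateField.topEquiv
  refine ⟨((IntermediateField.val _).comp
    (hx.aevalEquivField.symm.trans hy.aevalEquivField).toAlgHom).comp e.symm.toAlgHom, fun i => ?_⟩
  have hi : x i ∈ IntermediateField.adjoin K (Set.range x) :=
    IntermediateField.subset_adjoin _ _ ⟨i, rfl⟩
  have he : e.symm (x i) = ⟨x i, hi⟩ := by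
    rw [AlgEquiv.symm_apply_eq]
    rfl
  have hX : hx.aevalEquivField.symm ⟨x i, hi⟩ =
      algebraMap (MvPolynomial ι K) _ (MvPolynomial.X i) := by
    rw [AlgEquiv.symm_apply_eq]
    apply Subtype.ext
    rw [AlgebraicIndependent.aevalEquivField_algebraMap_apply_coe, MvPolynomial.aeval_X]
  change ((hy.aevalEquivField (hx.aevalEquivField.symm (e.symm (x i))) :
    IntermediateField.adjoin K (Set.range y)) : M) = y i
  rw [he, hX, AlgebraicIndependent.aevalEquivField_algebraMap_apply_coe, MvPolynomial.aeval_X]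

/-! ### Parameters with a single critical relation -/

section Specialisation

variable {r : ℕ}

/-- Gleason's polynomials `T, T ^ d + T, (T ^ d + T) ^ d + T, …`, the orbit of the critical point
`0` of `x ^ d + T`, which are separable because their derivatives are `1` modulo any prime factor
of `d`. -/
noncomputable def gleasonPoly (d : ℕ) : ℕ → ℤ[X]
  | 0 => X
  | n + 1 => gleasonPoly d n ^ d + X

theorem relPoly_zero_eq_map_gleasonPoly (n : ℕ) :
    relPoly (0 : Fin r → ℚ) n 0 0 = (gleasonPoly (r + 1) n).map (Int.castRingHom ℚ) := by
  have h0 : C ∘ (0 : Fin r → ℚ) = 0 := funext fun _ => C_0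
  rw [relPoly, C_0, sub_zero, h0]
  induction n with
  | zero => simp [critIter_succ', critPoly_zero, gleasonPoly]
  | succ n ih =>
    rw [critIter_succ', ih, critPoly_zero]
    simp [gleasonPoly]

theorem monic_gleasonPoly {d : ℕ} (hd : 2 ≤ d) (n : ℕ) : (gleasonPoly d n).Monic := by
  suffices h : (gleasonPoly d n).Monic ∧ 1 ≤ (gleasonPoly d n).natDegree from h.1
  induction n with
  | zero => exact ⟨monic_X, natDegree_X.ge⟩
  | succ n ih =>
    have hd' : (gleasonPoly d n ^ d).natDegree = d * (gleasonPoly d n).natDegree :=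
      ih.1.natDegree_pow d
    have hlt : (X : ℤ[X]).natDegree < (gleasonPoly d n ^ d).natDegree := by
      rw [hd', natDegree_X]
      nlinarith
    refine ⟨(ih.1.pow d).add_of_left (degree_lt_degree hlt), ?_⟩
    rw [gleasonPoly, natDegree_add_eq_left_of_natDegree_lt hlt, hd']
    nlinarith

theorem map_derivative_gleasonPoly {R : Type*} [CommRing R] {d : ℕ} (hd : (d : R) = 0) (n : ℕ) :
    (derivative (gleasonPoly d n)).map (Int.castRingHom R) = 1 := by
  have hd' : (d : R[X]) = 0 := by rw [← C_eq_natCast, hd, C_0]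
  cases n <;> simp [gleasonPoly, derivative_pow, hd']

theorem isCoprime_relPoly_zero (hr : 1 ≤ r) (n : ℕ) :
    IsCoprime (relPoly (0 : Fin r → ℚ) n 0 0) (derivative (relPoly (0 : Fin r → ℚ) n 0 0)) := by
  rw [relPoly_zero_eq_map_gleasonPoly, derivative_map]
  have hp : Fact (r + 1).minFac.Prime := ⟨Nat.minFac_prime (by omega)⟩
  refine isCoprime_map_of_isCoprime_map (monic_gleasonPoly (by omega) n)
    (Int.castRingHom (ZMod (r + 1).minFac)) _ Int.cast_injective ?_
  rw [map_derivative_gleasonPoly ((ZMod.natCast_eq_zero_iff _ _).2 (Nat.minFac_dvd _))]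
  exact isCoprime_one_right

theorem norm_le_norm_pow_mul_sub_add {𝕜 : Type*} [NormedField 𝕜] (hr : 1 ≤ r) {a τ x : 𝕜}
    (ha : 2 ≤ ‖a‖) (hx : 2 * ‖a‖ ≤ ‖x‖) (hτ : ‖τ‖ ≤ ‖x‖) : ‖x‖ ≤ ‖x ^ r * (x - a) + τ‖ := by
  have hsub : 2 ≤ ‖x - a‖ := by linarith [norm_sub_norm_le x a]
  have hpow : ‖x‖ ≤ ‖x‖ ^ r := le_self_pow₀ (by linarith) (by omega)
  have hmul : ‖x‖ * 2 ≤ ‖x ^ r * (x - a)‖ := by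
    rw [norm_mul, norm_pow]
    gcongr
  have htri := norm_sub_norm_le (x ^ r * (x - a)) (-τ)
  rw [norm_neg, sub_neg_eq_add] at htri
  linarith

/-- A far critical point: all critical points vanish except the `i`-th one, whose distance from
the origin is large enough for the orbit estimates below. -/
noncomputable def farCritical (i : Fin r) : Fin r → ℂ :=
  Function.update 0 i (r * (4 * (r + 1)))

section FarCritical

variable {i : Fin r}

theorem eval_critPoly_farCritical (x : ℂ) :
    (critPoly (farCritical i)).eval x = x ^ r * (x - 4 * (r + 1) ^ 2) := by
  rw [farCritical, critPoly_update_zero]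
  simp only [eval_sub, eval_pow, eval_X, eval_mul, eval_C]
  ring

theorem norm_four_mul_add_one_sq (r : ℕ) : ‖(4 * (r + 1) ^ 2 : ℂ)‖ = 4 * ((r : ℝ) + 1) ^ 2 := by
  exact_mod_cast Complex.norm_natCast (4 * (r + 1) ^ 2)

theorem norm_farCritical_self : ‖farCritical i i‖ = r * (4 * ((r : ℝ) + 1)) := by
  rw [farCritical, Function.update_self]
  exact_mod_cast Complex.norm_natCast (r * (4 * (r + 1)))

theorem norm_farCritical_lt (l : Fin r) : ‖farCritical i l‖ < 8 * ((r : ℝ) + 1) ^ 2 := by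
  by_cases hl : l = i
  · rw [hl, norm_farCritical_self]
    nlinarith [Nat.cast_nonneg (α := ℝ) r]
  · rw [farCritical, Function.update_of_ne hl, Pi.zero_apply, norm_zero]
    positivity

/-- Escape to infinity: no such orbit meets a critical point. -/
theorem le_norm_critIter_farCritical {τ x : ℂ} (hx : 8 * ((r : ℝ) + 1) ^ 2 ≤ ‖x‖) (hτ : ‖τ‖ ≤ ‖x‖)
    (n : ℕ) : 8 * ((r : ℝ) + 1) ^ 2 ≤ ‖critIter (farCritical i) τ n x‖ := by
  induction n generalizing x with
  | zero => exact hx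
  | succ _ ih =>
    have hstep : ‖x‖ ≤ ‖(critPoly (farCritical i)).eval x + τ‖ := by
      rw [eval_critPoly_farCritical]
      refine norm_le_norm_pow_mul_sub_add i.pos ?_ ?_ hτ <;> rw [norm_four_mul_add_one_sq]
      · nlinarith [Nat.cast_nonneg (α := ℝ) r]
      · linarith
    exact ih (hx.trans hstep) (hτ.trans hstep)

theorem norm_lt_of_critIter_farCritical_eq {j l : Fin r} (hij : i ≠ j) {τ : ℂ} {n : ℕ}
    (h : critIter (farCritical i) τ (n + 1) (farCritical i j) = farCritical i l) :
    ‖τ‖ < 8 * ((r : ℝ) + 1) ^ 2 := by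
  by_contra! hτ
  have hj : farCritical i j = 0 := Function.update_of_ne hij.symm _ _
  rw [critIter_succ, hj, eval_zero_critPoly, zero_add] at h
  exact (norm_farCritical_lt l).not_ge (h ▸ le_norm_critIter_farCritical hτ le_rfl n)

theorem le_norm_eval_critPoly_farCritical_self {τ : ℂ} (hτ : ‖τ‖ < 8 * ((r : ℝ) + 1) ^ 2) :
    8 * ((r : ℝ) + 1) ^ 2 ≤ ‖(critPoly (farCritical i)).eval (farCritical i i) + τ‖ := by
  have hr : (1 : ℝ) ≤ r := by exact_mod_cast i.pos
  have hsub : farCritical i i - 4 * (r + 1) ^ 2 = -((4 * (r + 1) : ℕ) : ℂ) := by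
    rw [farCritical, Function.update_self]
    push_cast
    ring
  have hpow : r * (4 * ((r : ℝ) + 1)) ≤ (r * (4 * ((r : ℝ) + 1))) ^ r :=
    le_self_pow₀ (by nlinarith) i.pos.ne'
  have hmul : 16 * ((r : ℝ) + 1) ^ 2 ≤ ‖(critPoly (farCritical i)).eval (farCritical i i)‖ := by
    rw [eval_critPoly_farCritical, hsub, norm_mul, norm_pow, norm_farCritical_self, norm_neg,
      Complex.norm_natCast]
    push_cast
    nlinarith
  have htri := norm_sub_norm_le ((critPoly (farCritical i)).eval (farCritical i i)) (-τ)
  rw [norm_neg, sub_neg_eq_add] at htri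
  linarith

theorem critIter_farCritical_ne {j l l' : Fin r} (hij : i ≠ j) {τ : ℂ} {m n : ℕ}
    (h : critIter (farCritical i) τ (n + 1) (farCritical i j) = farCritical i l) :
    critIter (farCritical i) τ (m + 1) (farCritical i i) ≠ farCritical i l' := by
  have hτ := norm_lt_of_critIter_farCritical_eq hij h
  have hfirst := le_norm_eval_critPoly_farCritical_self (i := i) hτ
  intro h'
  rw [critIter_succ] at h'
  exact (norm_farCritical_lt l').not_ge
    (h' ▸ le_norm_critIter_farCritical hfirst (hτ.le.trans hfirst) m)

end FarCritical

variable {k : Type*} [Field k] [Algebra ℚ k] {c : Fin r → k}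

theorem relPoly_eq_map_aeval (n : ℕ) (i j : Fin r) :
    relPoly c n (c i) (c j) = (relPoly (MvPolynomial.X : Fin r → MvPolynomial (Fin r) ℚ) n
      (MvPolynomial.X i) (MvPolynomial.X j)).map (MvPolynomial.aeval c).toRingHom := by
  have hX (i : Fin r) : (MvPolynomial.aeval (R := ℚ) c).toRingHom (MvPolynomial.X i) = c i :=
    MvPolynomial.aeval_X c i
  rw [map_relPoly, hX, hX]
  congr 1
  exact (funext hX).symm

theorem separable_relPoly (hc : AlgebraicIndependent ℚ c) (n : ℕ) (j : Fin r) :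
    (relPoly c n (c j) (c j)).Separable := by
  rw [relPoly_eq_map_aeval, Separable, derivative_map]
  refine isCoprime_map_of_isCoprime_map (monic_relPoly j.pos _ _ _ _)
    (MvPolynomial.aeval (0 : Fin r → ℚ)).toRingHom _ hc ?_
  rw [← derivative_map, ← relPoly_eq_map_aeval]
  exact isCoprime_relPoly_zero j.pos n

theorem isCoprime_relPoly_of_ne (hc : AlgebraicIndependent ℚ c) (m n : ℕ)
    {i j : Fin r} (hij : i ≠ j) (l l' : Fin r) :
    IsCoprime (relPoly c n (c j) (c l)) (relPoly c m (c i) (c l')) := by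
  rw [relPoly_eq_map_aeval, relPoly_eq_map_aeval]
  refine isCoprime_map_of_isCoprime_map (monic_relPoly i.pos _ _ _ _)
    (MvPolynomial.aeval (farCritical i)).toRingHom _ hc ?_
  rw [← relPoly_eq_map_aeval, ← relPoly_eq_map_aeval,
    isCoprime_iff_aeval_ne_zero_of_isAlgClosed ℂ ℂ]
  intro τ
  rw [or_iff_not_imp_left, not_not]
  simp only [coe_aeval_eq_eval, eval_relPoly, sub_eq_zero, ne_eq]
  exact critIter_farCritical_ne hij

theorem eval_ne_zero_of_isCoprime {R : Type*} [CommRing R] [Nontrivial R] {p q : R[X]}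
    (h : IsCoprime p q) {x : R} (hx : p.eval x = 0) : q.eval x ≠ 0 := by
  have hev := h.map (evalRingHom x)
  rw [coe_evalRingHom, hx, isCoprime_zero_left] at hev
  exact hev.ne_zero

/-- There are more parameters of period `n + 1` than parameters of smaller periods. -/
theorem exists_param_period [IsAlgClosed k] (hc : AlgebraicIndependent ℚ c) (n : ℕ)
    (j : Fin r) :
    ∃ τ : k, critIter c τ (n + 1) (c j) = c j ∧ ∀ m < n, critIter c τ (m + 1) (c j) ≠ c j := by
  classical
  let P : ℕ → k[X] := fun m => relPoly c m (c j) (c j)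
  have hmem (m : ℕ) (τ : k) :
      τ ∈ (P m).roots.toFinset ↔ critIter c τ (m + 1) (c j) = c j := by
    rw [Multiset.mem_toFinset, mem_roots (monic_relPoly j.pos _ _ _ _).ne_zero, IsRoot,
      eval_relPoly, sub_eq_zero]
  have hcard : (P n).roots.toFinset.card = (r + 1) ^ n := by
    rw [Multiset.toFinset_card_of_nodup (nodup_roots (separable_relPoly hc n j)),
      splits_iff_card_roots.1 (IsAlgClosed.splits _), natDegree_relPoly j.pos]
  have hsmall : ((Finset.range n).biUnion fun m => (P m).roots.toFinset).card < (r + 1) ^ n := by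
    refine Finset.card_biUnion_le.trans_lt
      (lt_of_le_of_lt (Finset.sum_le_sum (g := fun m => (r + 1) ^ m) fun m _ => ?_) ?_)
    · exact (Multiset.toFinset_card_le _).trans
        ((card_roots' _).trans (natDegree_relPoly j.pos _ _ _ _).le)
    · exact Nat.geomSum_lt (Nat.succ_le_succ j.pos) fun m => Finset.mem_range.1
  obtain ⟨τ, hτ, hτ'⟩ := Finset.exists_mem_notMem_of_card_lt_card (hsmall.trans_eq hcard.symm)
  refine ⟨τ, (hmem n τ).1 hτ, fun m hm h => hτ' ?_⟩
  exact Finset.mem_biUnion.2 ⟨m, Finset.mem_range.2 hm, (hmem m τ).2 h⟩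

/-- Among the relations `f ^ (m + 1) (c i) = c l` with `m ≤ n` between the critical points of
`f = critPoly c + τ`, exactly `f ^ (n + 1) (c j) = c j` holds. -/
def HasUniqueCriticalRelation {R : Type*} [CommRing R] [Algebra ℚ R] (c : Fin r → R) (τ : R) (n : ℕ)
    (j : Fin r) : Prop :=
  ∀ m ≤ n, ∀ i l, critIter c τ (m + 1) (c i) = c l ↔ m = n ∧ i = j ∧ l = j

theorem exists_hasUniqueCriticalRelation [IsAlgClosed k] (hc : AlgebraicIndependent ℚ c) (n : ℕ)
    (j : Fin r) :
    ∃ τ : k, HasUniqueCriticalRelation c τ n j ∧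
      (derivative (relPoly c n (c j) (c j))).eval τ ≠ 0 := by
  obtain ⟨τ, hτ, hτ'⟩ := exists_param_period hc n j
  have heval (m : ℕ) {i l : Fin r} (h : critIter c τ (m + 1) (c i) = c l) :
      (relPoly c m (c i) (c l)).eval τ = 0 := by rw [eval_relPoly, h, sub_self]
  have eq_of_rel {i l : Fin r} {m : ℕ} (h : critIter c τ (m + 1) (c i) = c l) : i = j := by
    by_contra hij
    exact eval_ne_zero_of_isCoprime (isCoprime_relPoly_of_ne hc m n hij j l) (heval n hτ)
      (heval m h)
  refine ⟨τ, fun m hm i l => ⟨fun h => ?_, ?_⟩,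
    eval_ne_zero_of_isCoprime (separable_relPoly hc n j) (heval n hτ)⟩
  · obtain rfl : i = j := eq_of_rel h
    obtain hmn | rfl := hm.lt_or_eq
    · have hl : l = i := by
        refine eq_of_rel (m := n - m - 1) (l := i) ?_
        rw [← h, ← critIter_add, show n - m - 1 + 1 + (m + 1) = n + 1 by omega, hτ]
      exact absurd (hl ▸ h) (hτ' m hmn)
    · exact ⟨rfl, rfl, hc.injective (h.symm.trans hτ)⟩
  · rintro ⟨rfl, rfl, rfl⟩
    exact hτ

end Specialisation

/-! ### Roots over power series rings -/

open scoped PowerSeries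

section Hensel

variable {k : Type*} [Field k]

theorem constantCoeff_eval (p : k⟦X⟧[X]) (x : k⟦X⟧) :
    PowerSeries.constantCoeff (p.eval x) =
      (p.map PowerSeries.constantCoeff).eval (PowerSeries.constantCoeff x) := by
  rw [eval_map, eval₂_hom]

theorem existsUnique_root_of_simple_root {p : k⟦X⟧[X]} (hp : p.Monic) {a : k}
    (ha : (p.map PowerSeries.constantCoeff).eval a = 0)
    (ha' : (derivative (p.map PowerSeries.constantCoeff)).eval a ≠ 0) :
    ∃! x : k⟦X⟧, p.eval x = 0 ∧ PowerSeries.constantCoeff x = a := by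
  obtain ⟨x, hx, hxa⟩ := HenselianRing.is_henselian
    (I := Ideal.span {(PowerSeries.X : k⟦X⟧)}) p hp (PowerSeries.C a)
    (by rwa [Ideal.mem_span_singleton, PowerSeries.X_dvd_iff, constantCoeff_eval,
      PowerSeries.constantCoeff_C])
    (IsUnit.map _ <| by rwa [PowerSeries.isUnit_iff_constantCoeff, constantCoeff_eval,
      ← derivative_map, PowerSeries.constantCoeff_C, isUnit_iff_ne_zero])
  rw [Ideal.mem_span_singleton, PowerSeries.X_dvd_iff, map_sub, PowerSeries.constantCoeff_C,
    sub_eq_zero] at hxa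
  refine ⟨x, ⟨hx, hxa⟩, fun y ⟨hy, hya⟩ => ?_⟩
  obtain ⟨q, hq⟩ := binomExpansion p x (y - x)
  rw [add_sub_cancel, hx, hy, zero_add, pow_two, ← mul_assoc, ← add_mul] at hq
  refine sub_eq_zero.1 ((mul_eq_zero.1 hq.symm).resolve_left fun h0 => ha' ?_)
  have hred := congrArg PowerSeries.constantCoeff h0
  rwa [map_add, map_mul, map_sub, hya, hxa, sub_self, mul_zero, add_zero, map_zero,
    constantCoeff_eval, ← derivative_map, hxa] at hred

theorem map_constantCoeff_roots {p : k⟦X⟧[X]} (hp : p.Monic) {g h : k[X]}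
    (hred : p.map PowerSeries.constantCoeff = g * h) (hgh : IsCoprime g h) (hsep : h.Separable)
    (hg : ∀ x, p.eval x = 0 → g.eval (PowerSeries.constantCoeff x) ≠ 0) :
    p.roots.map PowerSeries.constantCoeff = h.roots := by
  classical
  have hgh0 : g * h ≠ 0 := hred ▸ (hp.map _).ne_zero
  refine le_antisymm ?_ ((Multiset.le_iff_subset (nodup_roots hsep)).2 fun a ha => ?_)
  · have hle : p.roots.map PowerSeries.constantCoeff ≤ g.roots + h.roots := by
      rw [← roots_mul hgh0, ← hred]
      exact map_roots_le (hp.map _).ne_zero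
    refine Multiset.le_iff_count.2 fun b => ?_
    by_cases hb : b ∈ p.roots.map PowerSeries.constantCoeff
    · obtain ⟨x, hx, rfl⟩ := Multiset.mem_map.1 hb
      have hgx : PowerSeries.constantCoeff x ∉ g.roots :=
        fun h => hg x (mem_roots'.1 hx).2 (mem_roots'.1 h).2
      have hcount := Multiset.le_iff_count.1 hle (PowerSeries.constantCoeff x)
      rwa [Multiset.count_add, Multiset.count_eq_zero_of_notMem hgx, zero_add] at hcount
    · simp [Multiset.count_eq_zero_of_notMem hb]
  · have hroot : h.eval a = 0 := (mem_roots'.1 ha).2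
    obtain ⟨x, hx, hxa⟩ := (existsUnique_root_of_simple_root hp (a := a)
      (by rw [hred, eval_mul, hroot, mul_zero]) (by
        rw [hred, derivative_mul, eval_add, eval_mul, eval_mul, hroot, mul_zero, zero_add]
        exact mul_ne_zero (eval_ne_zero_of_isCoprime hgh.symm hroot)
          (eval_ne_zero_of_isCoprime hsep hroot))).exists
    exact Multiset.mem_map.2 ⟨x, (mem_roots hp.ne_zero).2 hx, hxa⟩

theorem exists_mem_of_aeval_prod_X_sub_C_eq_zero {A L : Type*} [CommRing A] [CommRing L]
    [IsDomain L] [Algebra A L] {s : Multiset A} {z : L}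
    (hz : aeval z (s.map fun a => X - C a).prod = 0) : ∃ x ∈ s, algebraMap A L x = z := by
  rw [map_multiset_prod, Multiset.map_map, Multiset.prod_eq_zero_iff, Multiset.mem_map] at hz
  obtain ⟨x, hx, hxz⟩ := hz
  simp only [Function.comp_apply, map_sub, aeval_X, aeval_C, sub_eq_zero] at hxz
  exact ⟨x, hx, hxz.symm⟩

theorem exists_algebraMap_eq_of_separable [IsAlgClosed k] {L : Type*} [Field L] [Algebra k⟦X⟧ L]
    {p : k⟦X⟧[X]} (hp : p.Monic) (hsep : (p.map PowerSeries.constantCoeff).Separable) {y : L}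
    (hy : aeval y p = 0) : ∃ x : k⟦X⟧, p.eval x = 0 ∧ algebraMap _ L x = y := by
  have hroots : p.roots.card = p.natDegree := by
    have hmap := map_constantCoeff_roots hp (one_mul _).symm isCoprime_one_left hsep (by simp)
    rw [← Multiset.card_map PowerSeries.constantCoeff, hmap,
      splits_iff_card_roots.1 (IsAlgClosed.splits _), hp.natDegree_map]
  rw [← prod_multiset_X_sub_C_of_monic_of_roots_card_eq hp hroots] at hy
  obtain ⟨x, hx, hxy⟩ := exists_mem_of_aeval_prod_X_sub_C_eq_zero hy
  exact ⟨x, (mem_roots hp.ne_zero).1 hx, hxy⟩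

end Hensel

section Conjugate

variable {A M L : Type*} [CommRing A] [IsIntegrallyClosed A] [Field M] [Algebra A M]
  [IsFractionRing A M] [Field L] [Algebra M L] [Algebra A L] [IsScalarTower A M L] [Normal M L]
  {p : A[X]}

theorem exists_algEquiv_of_irreducible (hp : p.Monic) (hirr : Irreducible p) {u v : L}
    (hu : aeval u p = 0) (hv : aeval v p = 0) : ∃ σ : Gal(L/M), σ u = v := by
  rw [hp.irreducible_iff_irreducible_map_fraction_map (K := M)] at hirr
  have hmin (w : L) (hw : aeval w p = 0) : minpoly M w = p.map (algebraMap A M) :=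
    (minpoly.eq_of_irreducible_of_monic hirr (by rwa [aeval_map_algebraMap]) (hp.map _)).symm
  exact isConjRoot_iff_exists_algEquiv.1 ((hmin v hv).trans (hmin u hu).symm)

variable (M) in
theorem exists_swap_of_card_roots_add_two [IsDomain A] [IsAlgClosed L] (hp : p.Monic)
    (hsep : (p.map (algebraMap A L)).Separable) (hcard : p.roots.card + 2 = p.natDegree) :
    ∃ u v : L, u ≠ v ∧ aeval u p = 0 ∧ aeval v p = 0 ∧ (∃ σ : Gal(L/M), σ u = v ∧ σ v = u) ∧
      ∀ z, aeval z p = 0 → z ≠ u → z ≠ v → z ∈ Set.range (algebraMap A L) := by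
  obtain ⟨q, hpq, hdeg, hq0⟩ := exists_prod_multiset_X_sub_C_mul p
  have hq : q.Monic := (monic_multisetProd_X_sub_C p.roots).of_mul_monic_left (hpq.symm ▸ hp)
  have hirr : Irreducible q :=
    (hq.irreducible_iff_roots_eq_zero_of_degree_le_three (by omega) (by omega)).2 hq0
  have hqp : q ∣ p := Dvd.intro_left _ hpq
  obtain ⟨u, v, huv⟩ : ∃ u v, (q.map (algebraMap A L)).roots = {u, v} := by
    rw [← Multiset.card_eq_two, splits_iff_card_roots.1 (IsAlgClosed.splits _), hq.natDegree_map]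
    omega
  have hne : u ≠ v := by
    have hnodup := nodup_roots (hsep.of_dvd (map_dvd (algebraMap A L) hqp))
    rw [huv] at hnodup
    simpa using hnodup
  have hmem (z : L) : aeval z q = 0 ↔ z = u ∨ z = v := by
    rw [aeval_def, ← eval_map, ← IsRoot, ← mem_roots (hq.map _).ne_zero, huv]
    simp
  have hu := (hmem u).2 (Or.inl rfl)
  have hv := (hmem v).2 (Or.inr rfl)
  obtain ⟨σ, hσ⟩ := exists_algEquiv_of_irreducible (M := M) hq hirr hu hv
  have hσv : aeval (σ v) q = 0 := by
    rw [← aeval_map_algebraMap M, aeval_algHom_apply, aeval_map_algebraMap, hv, map_zero]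
  refine ⟨u, v, hne, aeval_eq_zero_of_dvd_aeval_eq_zero hqp hu,
    aeval_eq_zero_of_dvd_aeval_eq_zero hqp hv, ⟨σ, hσ, ?_⟩, fun z hz hzu hzv => ?_⟩
  · exact ((hmem _).1 hσv).resolve_right fun h => hne (σ.injective (hσ.trans h.symm))
  · rw [← hpq, map_mul, mul_eq_zero, hmem, or_iff_left (not_or.2 ⟨hzu, hzv⟩)] at hz
    obtain ⟨x, -, hx⟩ := exists_mem_of_aeval_prod_X_sub_C_eq_zero hz
    exact ⟨x, hx⟩

end Conjugate

section Eisenstein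

variable {k M L : Type*} [Field k] [Field M] [Algebra k⟦X⟧ M] [IsFractionRing k⟦X⟧ M]
  [Field L] [Algebra M L] [Algebra k⟦X⟧ L] [IsScalarTower k⟦X⟧ M L]

theorem exists_algEquiv_of_eisenstein [Normal M L] {p : k⟦X⟧[X]} (hp : p.Monic)
    (hdeg : 0 < p.natDegree) (hred : p.map PowerSeries.constantCoeff = X ^ p.natDegree)
    (hconst : PowerSeries.coeff 1 (p.coeff 0) ≠ 0) {u v : L} (hu : aeval u p = 0)
    (hv : aeval v p = 0) : ∃ σ : Gal(L/M), σ u = v := by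
  have hE : p.IsEisensteinAt (Ideal.span {(PowerSeries.X : k⟦X⟧)}) := by
    refine ⟨?_, fun {n} hn => ?_, ?_⟩
    · rw [hp.leadingCoeff, Ideal.mem_span_singleton, PowerSeries.X_dvd_iff, map_one]
      exact one_ne_zero
    · rw [Ideal.mem_span_singleton, PowerSeries.X_dvd_iff, ← coeff_map, hred, coeff_X_pow,
        if_neg hn.ne]
    · rw [Ideal.span_singleton_pow, Ideal.mem_span_singleton, PowerSeries.X_pow_dvd_iff]
      exact fun h => hconst (h 1 one_lt_two)
  exact exists_algEquiv_of_irreducible hp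
    (hE.irreducible PowerSeries.span_X_isPrime hp.isPrimitive hdeg) hu hv

theorem exists_eq_X_sub_C_mul_of_map_eq {p : k⟦X⟧[X]} (hp : p.Monic) {a : k} (ha : a ≠ 0) {m : ℕ}
    (hm : 0 < m) (hred : p.map PowerSeries.constantCoeff = (X - C a) * X ^ m) :
    ∃ ρ Q, p = (X - C ρ) * Q ∧ Q.Monic ∧ Q.map PowerSeries.constantCoeff = X ^ m := by
  obtain ⟨ρ, hρ, hρa⟩ := (existsUnique_root_of_simple_root hp (a := a) (by simp [hred])
    (by simp [hred, ha, hm.ne'])).exists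
  obtain ⟨Q, hQ⟩ := dvd_iff_isRoot.2 hρ
  refine ⟨ρ, Q, hQ, (monic_X_sub_C ρ).of_mul_monic_left (hQ ▸ hp), ?_⟩
  rw [hQ, Polynomial.map_mul, Polynomial.map_sub, map_X, map_C, hρa] at hred
  exact mul_left_cancel₀ (X_sub_C_ne_zero _) hred

theorem exists_root_forall_ne_exists_algEquiv [Normal M L] {p : k⟦X⟧[X]} (hp : p.Monic) {a : k}
    (ha : a ≠ 0) {m : ℕ} (hm : 0 < m)
    (hred : p.map PowerSeries.constantCoeff = (X - C a) * X ^ m)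
    (hconst : PowerSeries.coeff 1 (p.coeff 0) ≠ 0) :
    ∃ ρ : k⟦X⟧, p.eval ρ = 0 ∧ ∀ u v : L, aeval u p = 0 → aeval v p = 0 →
      u ≠ algebraMap _ L ρ → v ≠ algebraMap _ L ρ → ∃ σ : Gal(L/M), σ u = v := by
  obtain ⟨ρ, Q, rfl, hQ, hQred⟩ := exists_eq_X_sub_C_mul_of_map_eq hp ha hm hred
  have hdeg : Q.natDegree = m := by
    rw [← hQ.natDegree_map PowerSeries.constantCoeff, hQred, natDegree_X_pow]
  have hQ0 : PowerSeries.coeff 1 (Q.coeff 0) ≠ 0 := by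
    have h0 : PowerSeries.constantCoeff (Q.coeff 0) = 0 := by
      rw [← coeff_map, hQred, coeff_X_pow, if_neg hm.ne]
    rw [mul_coeff_zero, PowerSeries.coeff_one_mul, h0, mul_zero, zero_add] at hconst
    exact left_ne_zero_of_mul hconst
  have hroot (w : L) (hw : aeval w ((X - C ρ) * Q) = 0) (hwρ : w ≠ algebraMap _ L ρ) :
      aeval w Q = 0 := by
    rw [map_mul, map_sub, aeval_X, aeval_C] at hw
    exact (mul_eq_zero.1 hw).resolve_left (sub_ne_zero.2 hwρ)
  refine ⟨ρ, by simp, fun u v hu hv huρ hvρ => ?_⟩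
  exact exists_algEquiv_of_eisenstein hQ (hdeg ▸ hm) (by rw [hdeg, hQred]) hQ0
    (hroot u hu huρ) (hroot v hv hvρ)

end Eisenstein

/-! ### Algebraically independent power series -/

section Independence

variable {K k : Type*} [Field K] [Field k] [Algebra K k] {r : ℕ}

theorem transcendental_powerSeries_X : Transcendental k (PowerSeries.X : k⟦X⟧) := by
  rw [transcendental_iff]
  intro p hp
  have h : aeval (PowerSeries.X : k⟦X⟧) p = (p : k⟦X⟧) := eval₂_C_X_eq_coe
  rw [h] at hp
  exact coe_injective k (hp.trans coe_zero.symm)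

theorem algebraicIndependent_X_C {c : Fin r → k} (hc : AlgebraicIndependent K c) :
    AlgebraicIndependent K (fun o : Option (Fin r) =>
      o.elim (PowerSeries.X : k⟦X⟧) (fun j => PowerSeries.C (c j))) := by
  have hX : AlgebraicIndependent k (fun _ : PUnit.{1} => (PowerSeries.X : k⟦X⟧)) :=
    algebraicIndependent_unique_type_iff.2 transcendental_powerSeries_X
  refine (algebraicIndependent_equiv' ((Equiv.optionEquivSumPUnit (Fin r)).trans
    (Equiv.sumComm _ _)) ?_).2 (hc.sumElim_comp hX)
  funext o
  cases o <;> rfl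

theorem isIntegral_of_isIntegral_critIter {N M : Type*} [Field N] [Field M] [Algebra ℚ M]
    [Algebra N M] {γ : Fin r → M} {t : M} (hγ : ∀ j, IsIntegral N (γ j)) (ht : IsIntegral N t)
    {n : ℕ} {y : M} (hy : IsIntegral N (critIter γ t n y)) : IsIntegral N y := by
  have : CharZero M := algebraRat.charZero M
  induction n generalizing y with
  | zero => exact hy
  | succ n ih =>
    have hstep : IsIntegral N ((critPoly γ).eval y + t) := ih hy
    let γ' : Fin r → algebraicClosure N M :=
      fun j => ⟨γ j, mem_algebraicClosure_iff.2 (hγ j).isAlgebraic⟩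
    let b : algebraicClosure N M :=
      ⟨(critPoly γ).eval y, mem_algebraicClosure_iff.2 <| by
        simpa using (hstep.sub ht).isAlgebraic⟩
    have hy' : IsIntegral (algebraicClosure N M) y := by
      refine ⟨critPoly γ' - C b, (monic_critPoly γ').sub_of_left (degree_lt_degree ?_), ?_⟩
      · rw [natDegree_C, natDegree_critPoly]
        omega
      · rw [eval₂_sub, eval₂_C, ← eval_map, map_critPoly]
        exact sub_self _
    exact isIntegral_trans y hy'

variable (M : Type*) [Field M] [Algebra k⟦X⟧ M] [IsFractionRing k⟦X⟧ M] [Algebra K M]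
  [IsScalarTower K k⟦X⟧ M]

theorem algebraicIndependent_of_isIntegral {c : Fin r → k} (hc : AlgebraicIndependent K c)
    {x : Option (Fin r) → k⟦X⟧}
    (hX : IsIntegral (IntermediateField.adjoin K (Set.range (algebraMap k⟦X⟧ M ∘ x)))
      (algebraMap k⟦X⟧ M PowerSeries.X))
    (hC : ∀ j, IsIntegral (IntermediateField.adjoin K (Set.range (algebraMap k⟦X⟧ M ∘ x)))
      (algebraMap k⟦X⟧ M (PowerSeries.C (c j)))) :
    AlgebraicIndependent K x := by
  have hy := (algebraicIndependent_X_C hc).map' (f := IsScalarTower.toAlgHom K k⟦X⟧ M)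
    (IsFractionRing.injective k⟦X⟧ M)
  refine .of_comp (IsScalarTower.toAlgHom K k⟦X⟧ M)
    (algebraicIndependent_of_isAlgebraic_adjoin hy fun o => ?_)
  cases o with
  | none => exact hX.isAlgebraic
  | some j => exact (hC j).isAlgebraic

end Independence

/-! ### Monodromy near degenerate polynomials -/

section Degenerate

variable {k : Type*} [Field k] [Algebra ℚ k] {r : ℕ}

theorem X_sq_dvd_critIter_sub_X {a : Fin r → k} {i : Fin r} (hi : a i = 0) (n : ℕ) :
    X ^ 2 ∣ critIter (C ∘ a) X n X - X := by
  induction n with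
  | zero => simp
  | succ n ih =>
    obtain ⟨h, hh⟩ := X_sq_dvd_critPoly hi
    have hX : X ∣ critIter (C ∘ a) X n X :=
      (dvd_sub_left dvd_rfl).1 ((dvd_pow_self X two_ne_zero).trans ih)
    rw [critIter_succ', eval_critPoly_C_comp, add_sub_cancel_right, hh, mul_comp, pow_comp, X_comp]
    exact (pow_dvd_pow_of_dvd hX 2).mul_right _

theorem exists_param_of_degenerate {γ : Fin r → k⟦X⟧} {i : Fin r}
    (hi : PowerSeries.constantCoeff (γ i) = 0) (n : ℕ) :
    ∃ t : k⟦X⟧, critIter γ t n (t - PowerSeries.X) = γ i := by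
  set Φ : k⟦X⟧[X] := critIter (C ∘ γ) X n (X - C PowerSeries.X) - C (γ i) with hΦ
  have hmonic : Φ.Monic := by
    have h := monic_critIter_and_natDegree i.pos γ (monic_X_sub_C (PowerSeries.X : k⟦X⟧))
      (natDegree_X_sub_C _) n
    refine h.1.sub_of_left (degree_lt_degree ?_)
    rw [natDegree_C, h.2]
    positivity
  obtain ⟨q, hq⟩ := X_sq_dvd_critIter_sub_X (a := PowerSeries.constantCoeff ∘ γ) hi n
  have hmap : Φ.map PowerSeries.constantCoeff = X + X ^ 2 * q := by
    rw [hΦ, Polynomial.map_sub, polynomial_map_critIter, map_C, hi, Polynomial.map_sub, map_X,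
      map_C, PowerSeries.constantCoeff_X, C_0, sub_zero, sub_zero, ← hq]
    ring
  obtain ⟨t, ht, -⟩ := (existsUnique_root_of_simple_root hmonic (a := 0) (by simp [hmap])
    (by simp [hmap])).exists
  refine ⟨t, ?_⟩
  rwa [hΦ, eval_sub, eval_critIter, eval_sub, eval_X, eval_C, eval_C, sub_eq_zero] at ht

theorem map_constantCoeff_fibrePoly_sub_X (γ : Fin r → k⟦X⟧) (t : k⟦X⟧) :
    (fibrePoly γ t (t - PowerSeries.X)).map PowerSeries.constantCoeff =
      critPoly (PowerSeries.constantCoeff ∘ γ) := by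
  rw [fibrePoly, sub_sub_cancel, Polynomial.map_add, map_critPoly, map_C,
    PowerSeries.constantCoeff_X, C_0, add_zero]

theorem coeff_one_coeff_zero_fibrePoly_sub_X (γ : Fin r → k⟦X⟧) (t : k⟦X⟧) :
    PowerSeries.coeff 1 ((fibrePoly γ t (t - PowerSeries.X)).coeff 0) ≠ 0 := by
  rw [fibrePoly, sub_sub_cancel, coeff_zero_eq_eval_zero, eval_add, eval_zero_critPoly, eval_C,
    zero_add, PowerSeries.coeff_one_X]
  exact one_ne_zero

variable {M L : Type*} [Field M] [Algebra k⟦X⟧ M] [IsFractionRing k⟦X⟧ M] [Field L]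
  [Algebra M L] [Algebra k⟦X⟧ L] [IsScalarTower k⟦X⟧ M L] [Normal M L] {γ : Fin r → k⟦X⟧}

theorem exists_algEquiv_of_totally_degenerate (hγ : PowerSeries.constantCoeff ∘ γ = 0)
    (t : k⟦X⟧) {u v : L} (hu : aeval u (fibrePoly γ t (t - PowerSeries.X)) = 0)
    (hv : aeval v (fibrePoly γ t (t - PowerSeries.X)) = 0) : ∃ σ : Gal(L/M), σ u = v := by
  have hdeg := natDegree_fibrePoly γ t (t - PowerSeries.X)
  refine exists_algEquiv_of_eisenstein (monic_fibrePoly ..) (hdeg ▸ r.succ_pos) ?_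
    (coeff_one_coeff_zero_fibrePoly_sub_X γ t) hu hv
  rw [map_constantCoeff_fibrePoly_sub_X, hγ, critPoly_zero, hdeg]

theorem exists_algEquiv_of_almost_degenerate {j : Fin r}
    (hγ : PowerSeries.constantCoeff ∘ γ = Function.update (0 : Fin r → k) j r) (t : k⟦X⟧) :
    ∃ ρ : k⟦X⟧, (fibrePoly γ t (t - PowerSeries.X)).eval ρ = 0 ∧
      ∀ u v : L, aeval u (fibrePoly γ t (t - PowerSeries.X)) = 0 →
        aeval v (fibrePoly γ t (t - PowerSeries.X)) = 0 →
        u ≠ algebraMap _ L ρ → v ≠ algebraMap _ L ρ → ∃ σ : Gal(L/M), σ u = v := by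
  have : CharZero k := algebraRat.charZero k
  have hred : (fibrePoly γ t (t - PowerSeries.X)).map PowerSeries.constantCoeff =
      (X - C (r + 1 : k)) * X ^ r := by
    have hupd := critPoly_update_zero (R := k) j 1
    rw [mul_one, mul_one] at hupd
    rw [map_constantCoeff_fibrePoly_sub_X, hγ, hupd]
    ring
  exact exists_root_forall_ne_exists_algEquiv (monic_fibrePoly ..)
    (by exact_mod_cast r.succ_ne_zero) j.pos hred (coeff_one_coeff_zero_fibrePoly_sub_X γ t)

end Degenerate

/-! ### Monodromy near a parameter with a single critical relation -/

section GaloisProperties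

variable (B : Type*) {L : Type*} [Field B] [Field L] [Algebra ℚ L] [Algebra B L] {r : ℕ}
  (γ : Fin r → L) (t : L) (n : ℕ) (i : Fin r)

/-- Some automorphism transposes two siblings in the `(n + 1)`-st preimage of `γ i` and fixes
all other `(n + 1)`-st preimages of critical points. -/
def GaloisSwap : Prop :=
  ∃ u v : L, u ≠ v ∧ (critPoly γ).eval u = (critPoly γ).eval v ∧ critIter γ t (n + 1) u = γ i ∧
    ∃ σ : Gal(L/B), σ u = v ∧ σ v = u ∧
      ∀ l z, critIter γ t (n + 1) z = γ l → z ≠ u → z ≠ v → σ z = z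

/-- The Galois group is transitive on the fibre over some `n`-th preimage of `γ i`. -/
def GaloisTransitive : Prop :=
  ∃ x : L, critIter γ t n x = γ i ∧ ∀ u v, (critPoly γ).eval u + t = x →
    (critPoly γ).eval v + t = x → ∃ σ : Gal(L/B), σ u = v

/-- The stabiliser of some `w` in the fibre over some `n`-th preimage of `γ i` is transitive on
the rest of that fibre. -/
def GaloisSiblings : Prop :=
  ∃ x : L, critIter γ t n x = γ i ∧ ∃ w, (critPoly γ).eval w + t = x ∧
    ∀ u v, (critPoly γ).eval u + t = x → (critPoly γ).eval v + t = x → u ≠ w → v ≠ w →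
      ∃ σ : Gal(L/B), σ w = w ∧ σ u = v

end GaloisProperties

theorem dvd_critIter_sub_critIter {R : Type*} [CommRing R] [Algebra ℚ R] {r : ℕ} (γ : Fin r → R)
    (t : R) (n : ℕ) {b x y : R} (h : b ∣ x - y) :
    b ∣ critIter γ t n x - critIter γ t n y := by
  induction n with
  | zero => exact h
  | succ n ih =>
    rw [critIter_succ', critIter_succ', add_sub_add_right_eq_sub]
    exact ih.trans (sub_dvd_eval_sub _ _ _)

section LocalSwap

variable {k : Type*} [Field k] [Algebra ℚ k] {r : ℕ} {γ : Fin r → k⟦X⟧} {t : k⟦X⟧}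

theorem existsUnique_eval_critPoly_add_eq {y : k⟦X⟧} {b : k}
    (hb : (critPoly (PowerSeries.constantCoeff ∘ γ)).eval b + PowerSeries.constantCoeff t =
      PowerSeries.constantCoeff y)
    (hb' : ∀ i, b ≠ PowerSeries.constantCoeff (γ i)) :
    ∃! x, (critPoly γ).eval x + t = y ∧ PowerSeries.constantCoeff x = b := by
  simp only [← eval_fibrePoly_eq_zero]
  refine existsUnique_root_of_simple_root (monic_fibrePoly γ t y) ?_ ?_
  · rw [map_fibrePoly, eval_fibrePoly_eq_zero, hb]
  · rw [map_fibrePoly, derivative_fibrePoly]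
    exact fun h => (exists_eq_of_eval_derivative_critPoly h).elim hb'

theorem existsUnique_critIter_eq {m : ℕ}
    (hγ : ∀ m' < m, ∀ i l, critIter (PowerSeries.constantCoeff ∘ γ) (PowerSeries.constantCoeff t)
      (m' + 1) (PowerSeries.constantCoeff (γ i)) ≠ PowerSeries.constantCoeff (γ l))
    {b : k} {l : Fin r}
    (hb : critIter (PowerSeries.constantCoeff ∘ γ) (PowerSeries.constantCoeff t) m b =
      PowerSeries.constantCoeff (γ l)) :
    ∃! x, critIter γ t m x = γ l ∧ PowerSeries.constantCoeff x = b := by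
  induction m generalizing b with
  | zero => exact ⟨γ l, ⟨rfl, hb.symm⟩, fun x hx => hx.1⟩
  | succ m ih =>
    obtain ⟨y, ⟨hy, hyb⟩, hyu⟩ := ih (fun m' hm' => hγ m' (by omega)) hb
    obtain ⟨x, ⟨hx, hxb⟩, hxu⟩ := existsUnique_eval_critPoly_add_eq hyb.symm
      fun i hi => hγ m m.lt_succ_self i l (hi ▸ hb)
    refine ⟨x, ⟨by rw [critIter_succ, hx, hy], hxb⟩, fun x' ⟨hx', hxb'⟩ => hxu x' ⟨?_, hxb'⟩⟩
    exact hyu _ ⟨hx', by rw [map_add, map_eval_critPoly, hxb']⟩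

theorem X_sq_dvd_critIter_succ_sub {n : ℕ} {j : Fin r} {x y : k⟦X⟧}
    (hx : (critPoly γ).eval x + t = y)
    (hxj : PowerSeries.constantCoeff x = PowerSeries.constantCoeff (γ j)) :
    PowerSeries.X ^ 2 ∣ critIter γ t (n + 1) (γ j) - critIter γ t n y := by
  have hdvd : PowerSeries.X ∣ x - γ j := by
    rw [PowerSeries.X_dvd_iff, map_sub, hxj, sub_self]
  obtain ⟨q, hq⟩ := binomExpansion (critPoly γ) (γ j) (x - γ j)
  rw [add_sub_cancel, eval_derivative_critPoly_self, zero_mul, add_zero] at hq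
  refine dvd_critIter_sub_critIter γ t n ?_
  rw [← hx, hq, add_sub_add_right_eq_sub, dvd_sub_comm, add_sub_cancel_left]
  exact (pow_dvd_pow_of_dvd hdvd 2).mul_left _

theorem not_X_sq_dvd_critIter_sub {c : Fin r → k} {τ : k} {n : ℕ} {j : Fin r}
    (hj : critIter c τ (n + 1) (c j) = c j)
    (hj' : (derivative (relPoly c n (c j) (c j))).eval τ ≠ 0) :
    ¬ PowerSeries.X ^ 2 ∣ critIter (PowerSeries.C ∘ c) (PowerSeries.C τ + PowerSeries.X) (n + 1)
      (PowerSeries.C (c j)) - PowerSeries.C (c j) := by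
  set P := relPoly c n (c j) (c j)
  rw [← eval_relPoly, ← map_relPoly]
  obtain ⟨q, hq⟩ := binomExpansion (P.map PowerSeries.C) (PowerSeries.C τ) PowerSeries.X
  rw [hq, eval_map, eval₂_at_apply, eval_relPoly, hj, sub_self, map_zero, zero_add,
    derivative_map, eval_map, eval₂_at_apply, dvd_add_left (dvd_mul_left _ _),
    PowerSeries.X_pow_dvd_iff]
  intro h
  have hcoeff := h 1 one_lt_two
  rw [PowerSeries.coeff_C_mul, PowerSeries.coeff_one_X, mul_one] at hcoeff
  exact hj' hcoeff

variable {M L : Type*} [Field M] [Algebra k⟦X⟧ M] [IsFractionRing k⟦X⟧ M] [Field L] [Algebra ℚ L]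
  [Algebra M L] [Algebra k⟦X⟧ L] [IsScalarTower k⟦X⟧ M L] [IsAlgClosed k]

theorem exists_algebraMap_eq_of_eval_critPoly_add_eq {y : k⟦X⟧}
    (hy : ∀ i, (critPoly (PowerSeries.constantCoeff ∘ γ)).eval (PowerSeries.constantCoeff (γ i)) +
      PowerSeries.constantCoeff t ≠ PowerSeries.constantCoeff y) {z : L}
    (hz : (critPoly (algebraMap _ L ∘ γ)).eval z + algebraMap _ L t = algebraMap _ L y) :
    ∃ x, (critPoly γ).eval x + t = y ∧ algebraMap _ L x = z := by
  have hsep : (fibrePoly (PowerSeries.constantCoeff ∘ γ) (PowerSeries.constantCoeff t)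
      (PowerSeries.constantCoeff y)).Separable := separable_fibrePoly hy
  rw [← map_fibrePoly] at hsep
  simpa only [eval_fibrePoly_eq_zero] using exists_algebraMap_eq_of_separable
    (monic_fibrePoly γ t y) hsep (aeval_fibrePoly_eq_zero.2 hz)

theorem exists_algebraMap_eq_of_critIter_eq {m : ℕ}
    (hγ : ∀ m' < m, ∀ i l, critIter (PowerSeries.constantCoeff ∘ γ) (PowerSeries.constantCoeff t)
      (m' + 1) (PowerSeries.constantCoeff (γ i)) ≠ PowerSeries.constantCoeff (γ l))
    {z : L} {l : Fin r}
    (hz : critIter (algebraMap _ L ∘ γ) (algebraMap _ L t) m z = algebraMap _ L (γ l)) :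
    ∃ x, critIter γ t m x = γ l ∧ algebraMap _ L x = z := by
  induction m generalizing z with
  | zero => exact ⟨γ l, rfl, hz.symm⟩
  | succ m ih =>
    obtain ⟨y, hy, hyz⟩ := ih (fun m' hm' => hγ m' (by omega)) hz
    obtain ⟨x, hx, hxz⟩ := exists_algebraMap_eq_of_eval_critPoly_add_eq
      (fun i hi => hγ m m.lt_succ_self i l (by
        rw [critIter_succ, hi, ← map_critIter, hy]))
      hyz.symm
    exact ⟨x, by rw [critIter_succ, hx, hy], hxz⟩

theorem card_roots_fibrePoly_add_two {j : Fin r}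
    (hj : ∀ i, (critPoly (PowerSeries.constantCoeff ∘ γ)).eval (PowerSeries.constantCoeff (γ i)) =
      (critPoly (PowerSeries.constantCoeff ∘ γ)).eval (PowerSeries.constantCoeff (γ j)) → i = j)
    {y : k⟦X⟧} (hy : PowerSeries.constantCoeff y = (critPoly (PowerSeries.constantCoeff ∘ γ)).eval
      (PowerSeries.constantCoeff (γ j)) + PowerSeries.constantCoeff t)
    (hyj : ∀ x, (critPoly γ).eval x + t = y →
      PowerSeries.constantCoeff x ≠ PowerSeries.constantCoeff (γ j)) :
    (fibrePoly γ t y).roots.card + 2 = r + 1 := by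
  obtain ⟨h, hred, hh, hsep⟩ := exists_fibrePoly_eq_sq_mul
    (γ := PowerSeries.constantCoeff ∘ γ) hj (PowerSeries.constantCoeff t)
  have hcop : IsCoprime ((X - C ((PowerSeries.constantCoeff ∘ γ) j)) ^ 2) h :=
    ((irreducible_X_sub_C _).coprime_iff_not_dvd.2 fun hd => hh (dvd_iff_isRoot.1 hd)).pow_left
  have hroots : (fibrePoly γ t y).roots.map PowerSeries.constantCoeff = h.roots := by
    refine map_constantCoeff_roots (monic_fibrePoly γ t y) ?_ hcop hsep fun x hx => ?_
    · rw [map_fibrePoly, hy, ← hred, Function.comp_apply]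
    · rw [eval_pow, eval_sub, eval_X, eval_C]
      exact pow_ne_zero 2 (sub_ne_zero.2 (hyj x (eval_fibrePoly_eq_zero.1 hx)))
  rw [← Multiset.card_map PowerSeries.constantCoeff, hroots,
    splits_iff_card_roots.1 (IsAlgClosed.splits h), add_comm,
    ← natDegree_fibrePoly _ (PowerSeries.constantCoeff t), hred,
    ((monic_X_sub_C _).pow 2).natDegree_mul' (right_ne_zero_of_mul
      (hred ▸ (monic_fibrePoly ..).ne_zero)), natDegree_pow, natDegree_X_sub_C, mul_one]

theorem exists_swap_of_reduction_eq [IsAlgClosed L] [Normal M L] {n : ℕ}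
    {j : Fin r}
    (hj : ∀ i, critIter (PowerSeries.constantCoeff ∘ γ) (PowerSeries.constantCoeff t) (n + 1)
      (PowerSeries.constantCoeff (γ i)) = PowerSeries.constantCoeff (γ j) → i = j)
    (hj' : ¬ PowerSeries.X ^ 2 ∣ critIter γ t (n + 1) (γ j) - γ j) {y : k⟦X⟧}
    (hy : critIter γ t n y = γ j)
    (hyj : PowerSeries.constantCoeff y = (critPoly (PowerSeries.constantCoeff ∘ γ)).eval
      (PowerSeries.constantCoeff (γ j)) + PowerSeries.constantCoeff t) :
    ∃ u v : L, u ≠ v ∧ aeval u (fibrePoly γ t y) = 0 ∧ aeval v (fibrePoly γ t y) = 0 ∧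
      (∃ σ : Gal(L/M), σ u = v ∧ σ v = u) ∧
      ∀ z, aeval z (fibrePoly γ t y) = 0 → z ≠ u → z ≠ v → z ∈ Set.range (algebraMap k⟦X⟧ L) := by
  have hinj : Function.Injective (algebraMap k⟦X⟧ L) :=
    algebraMap_injective_of_field_isFractionRing k⟦X⟧ L M L
  have hrel (i : Fin r) (h : critIter γ t (n + 1) (γ i) = γ j) : i = j :=
    hj i (by rw [← map_critIter, h])
  have hne (i : Fin r) : (critPoly (algebraMap _ L ∘ γ)).eval (algebraMap _ L (γ i)) +
      algebraMap _ L t ≠ algebraMap _ L y := by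
    rw [← map_eval_critPoly, ← map_add, hinj.ne_iff]
    intro h
    have hi : critIter γ t (n + 1) (γ i) = γ j := by rw [critIter_succ, h, hy]
    obtain rfl := hrel i hi
    exact hj' (by rw [hi, sub_self]; exact dvd_zero _)
  have hsep : (fibrePoly (algebraMap _ L ∘ γ) (algebraMap _ L t) (algebraMap _ L y)).Separable :=
    separable_fibrePoly hne
  have hcrit (i : Fin r) (hi : (critPoly (PowerSeries.constantCoeff ∘ γ)).eval
      (PowerSeries.constantCoeff (γ i)) = (critPoly (PowerSeries.constantCoeff ∘ γ)).eval
      (PowerSeries.constantCoeff (γ j))) : i = j :=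
    hj i (by rw [critIter_succ, hi, ← hyj, ← map_critIter, hy])
  have hcard := card_roots_fibrePoly_add_two hcrit hyj
    fun x hx hxj => hj' (by
      have h := X_sq_dvd_critIter_succ_sub (n := n) hx hxj
      rwa [hy] at h)
  refine exists_swap_of_card_roots_add_two M (monic_fibrePoly γ t y) ?_ ?_
  · rwa [map_fibrePoly]
  · rw [hcard, natDegree_fibrePoly]

theorem galoisSwap_of_hasUniqueCriticalRelation [IsAlgClosed L] [Normal M L]
    {n : ℕ} {j : Fin r}
    (hj : HasUniqueCriticalRelation (PowerSeries.constantCoeff ∘ γ) (PowerSeries.constantCoeff t)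
      n j)
    (hj' : ¬ PowerSeries.X ^ 2 ∣ critIter γ t (n + 1) (γ j) - γ j) :
    GaloisSwap M (algebraMap _ L ∘ γ) (algebraMap _ L t) n j := by
  have hlt : ∀ m < n, ∀ i l, critIter (PowerSeries.constantCoeff ∘ γ)
      (PowerSeries.constantCoeff t) (m + 1) (PowerSeries.constantCoeff (γ i)) ≠
        PowerSeries.constantCoeff (γ l) :=
    fun m hm i l h => hm.ne ((hj m hm.le i l).1 h).1
  have hfix (σ : Gal(L/M)) (x : k⟦X⟧) : σ (algebraMap _ L x) = algebraMap _ L x := by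
    rw [IsScalarTower.algebraMap_apply k⟦X⟧ M L, AlgEquiv.commutes]
  obtain ⟨y, ⟨hy, hyj⟩, hyu⟩ :=
    existsUnique_critIter_eq hlt (l := j) ((hj n le_rfl j j).2 ⟨rfl, rfl, rfl⟩)
  obtain ⟨u, v, huv, hu, hv, ⟨σ, hσu, hσv⟩, hrange⟩ := exists_swap_of_reduction_eq (M := M) (L := L)
    (fun i h => ((hj n le_rfl i j).1 h).2.1) hj' hy hyj
  rw [aeval_fibrePoly_eq_zero] at hu hv
  refine ⟨u, v, huv, add_right_cancel (hu.trans hv.symm), ?_, σ, hσu, hσv,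
    fun l z hz hzu hzv => ?_⟩
  · rw [critIter_succ, hu, ← map_critIter, hy, Function.comp_apply]
  · suffices z ∈ Set.range (algebraMap k⟦X⟧ L) by
      obtain ⟨x, rfl⟩ := this
      exact hfix σ x
    obtain ⟨y', hy', hyz⟩ := exists_algebraMap_eq_of_critIter_eq hlt hz
    by_cases hyy : y' = y
    · subst hyy
      exact hrange z (aeval_fibrePoly_eq_zero.2 hyz.symm) hzu hzv
    · have hne (i : Fin r) : (critPoly (PowerSeries.constantCoeff ∘ γ)).eval
          (PowerSeries.constantCoeff (γ i)) + PowerSeries.constantCoeff t ≠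
            PowerSeries.constantCoeff y' := fun hi => hyy <| by
        obtain ⟨-, rfl, rfl⟩ := (hj n le_rfl i l).1 (by
          rw [critIter_succ, Function.comp_apply, hi, ← map_critIter, hy', Function.comp_apply])
        exact hyu y' ⟨hy', hi.symm⟩
      obtain ⟨x, -, hx⟩ := exists_algebraMap_eq_of_eval_critPoly_add_eq hne hyz.symm
      exact ⟨x, hx⟩

end LocalSwap

/-! ### The generic polynomial -/

universe u

section Generic

variable {K B : Type*} [Field K] [Field B] [Algebra K B] {r : ℕ}

variable (K) in
/-- The polynomial `critPoly γ + t` is generic over `K`: its critical points and its constant term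
are independent transcendentals over `K`, and they generate the ground field `B`. -/
structure IsGeneric (γ : Fin r → B) (t : B) : Prop where
  algebraicIndependent : AlgebraicIndependent K fun o : Option (Fin r) => o.elim t γ
  adjoin_eq_top : IntermediateField.adjoin K (Set.range fun o : Option (Fin r) => o.elim t γ) = ⊤

theorem critIter_ne_of_algebraicIndependent [Algebra ℚ B] {γ : Fin r → B} {t : B}
    (h : AlgebraicIndependent K fun o : Option (Fin r) => o.elim t γ) (m : ℕ) (i l : Fin r) :
    critIter γ t (m + 1) (γ i) ≠ γ l := by
  have : CharZero B := algebraRat.charZero B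
  have : CharZero K := (algebraMap K B).charZero_iff (algebraMap K B).injective |>.2 this
  intro he
  have ht := (AlgebraicIndependent.option_iff.1 h).2
  let γ₀ : Fin r → Algebra.adjoin K (Set.range γ) := fun j =>
    ⟨γ j, Algebra.subset_adjoin ⟨j, rfl⟩⟩
  refine (monic_relPoly i.pos γ₀ m (γ₀ i) (γ₀ l)).ne_zero (transcendental_iff.1 ht _ ?_)
  rw [aeval_def, ← eval_map, map_relPoly, eval_relPoly, sub_eq_zero]
  exact he

theorem exists_isAlgClosed_algebraicIndependent (K : Type u) [Field K] (r : ℕ) :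
    ∃ (k : Type u) (_ : Field k) (_ : Algebra K k) (_ : IsAlgClosed k) (c : Fin r → k),
      AlgebraicIndependent K c := by
  refine ⟨AlgebraicClosure (FractionRing (MvPolynomial (Fin r) K)), inferInstance, inferInstance,
    inferInstance, fun j => algebraMap (MvPolynomial (Fin r) K) _ (MvPolynomial.X j), ?_⟩
  exact (MvPolynomial.algebraicIndependent_X (Fin r) K).map'
    (f := IsScalarTower.toAlgHom K (MvPolynomial (Fin r) K)
      (AlgebraicClosure (FractionRing (MvPolynomial (Fin r) K))))
    ((algebraMap (FractionRing (MvPolynomial (Fin r) K)) _).injective.comp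
      (IsFractionRing.injective (MvPolynomial (Fin r) K) _))

end Generic

section Transfer

variable {K B A M L : Type*} [Field K] [Field B] [Field A] [Field M] [Field L] [Algebra B A]
  [Algebra M L] {r : ℕ}

theorem IsGeneric.exists_ringHom {R : Type*} [CommRing R] [Algebra K R] [Algebra R M]
    [IsFractionRing R M] [Algebra R L] [IsScalarTower R M L] [Algebra K B] [Algebra K M]
    [IsScalarTower K R M] [Algebra.IsAlgebraic B A] [IsAlgClosed A] [IsAlgClosed L]
    {γ : Fin r → B} {t : B} (h : IsGeneric K γ t) {γ' : Fin r → R} {t' : R}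
    (h' : AlgebraicIndependent K fun o : Option (Fin r) => o.elim t' γ') :
    ∃ ψ : A →+* L, ψ ∘ algebraMap B A ∘ γ = algebraMap R L ∘ γ' ∧
      ψ (algebraMap B A t) = algebraMap R L t' ∧
      ∀ σ' : Gal(L/M), ∃ σ : Gal(A/B), ∀ x, ψ (σ x) = σ' (ψ x) := by
  obtain ⟨ψ₀, hψ₀⟩ := exists_algHom_of_algebraicIndependent h.algebraicIndependent h.adjoin_eq_top
    (h'.map' (f := IsScalarTower.toAlgHom K R M) (IsFractionRing.injective R M))
  let _ : Algebra B L := ((algebraMap M L).comp ψ₀.toRingHom).toAlgebra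
  let ψ : A →ₐ[B] L := IsAlgClosed.lift
  have hψ (b : B) : ψ (algebraMap B A b) = algebraMap M L (ψ₀ b) := ψ.commutes b
  let _ : Algebra A L := ψ.toRingHom.toAlgebra
  have _ : IsScalarTower B A L := IsScalarTower.of_algebraMap_eq fun b => (ψ.commutes b).symm
  have _ : IsAlgClosure B A := ⟨inferInstance, inferInstance⟩
  have hψx (o : Option (Fin r)) :
      ψ (algebraMap B A (o.elim t γ)) = algebraMap R L (o.elim t' γ') := by
    rw [hψ, hψ₀, IsScalarTower.algebraMap_apply R M L]
    rfl
  refine ⟨ψ.toRingHom, funext fun j => hψx (some j), hψx none, fun σ' => ?_⟩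
  let σ'' : Gal(L/B) := AlgEquiv.ofRingEquiv (f := σ'.toRingEquiv) fun b => σ'.commutes (ψ₀ b)
  exact ⟨σ''.restrictNormal A, fun x => σ''.restrictNormal_commutes A x⟩

variable [Algebra ℚ A] [Algebra ℚ L] [IsAlgClosed A] (ψ : A →+* L)

theorem exists_preimage_of_eval_critPoly_add {γ : Fin r → A} {t x : A} {y : L}
    (h : (critPoly (ψ ∘ γ)).eval y + ψ t = ψ x) :
    ∃ x', ψ x' = y ∧ (critPoly γ).eval x' + t = x := by
  have hroot : ((fibrePoly γ t x).map ψ).IsRoot y := by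
    rwa [IsRoot, map_fibrePoly, eval_fibrePoly_eq_zero]
  obtain ⟨x', rfl⟩ :=
    (IsAlgClosed.splits _).mem_range_of_isRoot (monic_fibrePoly γ t x).ne_zero hroot
  refine ⟨x', rfl, ψ.injective ?_⟩
  rw [map_add, map_eval_critPoly, h]

theorem exists_preimage_of_critIter {γ : Fin r → A} {t x : A} {n : ℕ} {y : L}
    (h : critIter (ψ ∘ γ) (ψ t) n y = ψ x) : ∃ x', ψ x' = y ∧ critIter γ t n x' = x := by
  induction n generalizing y with
  | zero => exact ⟨x, h.symm, rfl⟩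
  | succ n ih =>
    obtain ⟨z, hz, hzx⟩ := ih h
    obtain ⟨x', hx', hx''⟩ := exists_preimage_of_eval_critPoly_add ψ hz.symm
    exact ⟨x', hx', by rw [critIter_succ, hx'', hzx]⟩

variable {ψ} {γ : Fin r → A} {t : A} {n : ℕ} {i : Fin r}
  (hψ : ∀ σ' : Gal(L/M), ∃ σ : Gal(A/B), ∀ x, ψ (σ x) = σ' (ψ x))
include hψ

theorem GaloisSwap.of_ringHom (h : GaloisSwap M (ψ ∘ γ) (ψ t) n i) : GaloisSwap B γ t n i := by
  obtain ⟨u, v, huv, he, hu, σ', hu', hv', hfix⟩ := h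
  obtain ⟨u, rfl, hui⟩ := exists_preimage_of_critIter ψ hu
  obtain ⟨v, rfl, hv⟩ := exists_preimage_of_eval_critPoly_add ψ (γ := γ) (t := 0)
    (x := (critPoly γ).eval u) (y := v) (by rw [map_eval_critPoly, he, map_zero, add_zero])
  obtain ⟨σ, hσ⟩ := hψ σ'
  refine ⟨u, v, fun h => huv (congrArg ψ h), by rw [← hv, add_zero], hui, σ,
    ψ.injective (by rw [hσ, hu']), ψ.injective (by rw [hσ, hv']), fun l z hz hzu hzv => ?_⟩
  refine ψ.injective ((hσ z).trans (hfix l _ ?_ (ψ.injective.ne hzu) (ψ.injective.ne hzv)))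
  rw [← map_critIter, hz, Function.comp_apply]

theorem GaloisTransitive.of_ringHom (h : GaloisTransitive M (ψ ∘ γ) (ψ t) n i) :
    GaloisTransitive B γ t n i := by
  obtain ⟨x, hx, h⟩ := h
  obtain ⟨x, rfl, hx'⟩ := exists_preimage_of_critIter ψ hx
  refine ⟨x, hx', fun u v hu hv => ?_⟩
  obtain ⟨σ', h'⟩ := h (ψ u) (ψ v) (by rw [← map_eval_critPoly, ← map_add, hu])
    (by rw [← map_eval_critPoly, ← map_add, hv])
  obtain ⟨σ, hσ⟩ := hψ σ'
  exact ⟨σ, ψ.injective (by rw [hσ, h'])⟩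

theorem GaloisSiblings.of_ringHom (h : GaloisSiblings M (ψ ∘ γ) (ψ t) n i) :
    GaloisSiblings B γ t n i := by
  obtain ⟨x, hx, w, hw, h⟩ := h
  obtain ⟨x, rfl, hx'⟩ := exists_preimage_of_critIter ψ hx
  obtain ⟨w, rfl, hw'⟩ := exists_preimage_of_eval_critPoly_add ψ hw
  refine ⟨x, hx', w, hw', fun u v hu hv huw hvw => ?_⟩
  obtain ⟨σ', hσw, hσu⟩ := h (ψ u) (ψ v) (by rw [← map_eval_critPoly, ← map_add, hu])
    (by rw [← map_eval_critPoly, ← map_add, hv]) (ψ.injective.ne huw) (ψ.injective.ne hvw)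
  obtain ⟨σ, hσ⟩ := hψ σ'
  exact ⟨σ, ψ.injective (by rw [hσ, hσw]), ψ.injective (by rw [hσ, hσu])⟩

end Transfer

section DegenerateMonodromy

variable {k M L : Type*} [Field k] [Algebra ℚ k] [Field M] [Algebra k⟦X⟧ M] [IsFractionRing k⟦X⟧ M]
  [Field L] [Algebra ℚ L] [Algebra M L] [Algebra k⟦X⟧ L] [IsScalarTower k⟦X⟧ M L] [Normal M L]
  {r n : ℕ} {γ : Fin r → k⟦X⟧} {t : k⟦X⟧} {i : Fin r}

theorem galoisTransitive_of_totally_degenerate (hγ : PowerSeries.constantCoeff ∘ γ = 0)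
    (ht : critIter γ t n (t - PowerSeries.X) = γ i) :
    GaloisTransitive M (algebraMap _ L ∘ γ) (algebraMap _ L t) n i := by
  refine ⟨algebraMap _ L (t - PowerSeries.X), by rw [← map_critIter, ht, Function.comp_apply],
    fun u v hu hv => ?_⟩
  rw [← aeval_fibrePoly_eq_zero] at hu hv
  exact exists_algEquiv_of_totally_degenerate hγ t hu hv

theorem galoisSiblings_of_almost_degenerate {j : Fin r}
    (hγ : PowerSeries.constantCoeff ∘ γ = Function.update (0 : Fin r → k) j r)
    (ht : critIter γ t n (t - PowerSeries.X) = γ i) :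
    GaloisSiblings M (algebraMap _ L ∘ γ) (algebraMap _ L t) n i := by
  obtain ⟨ρ, hρ, hρ'⟩ := exists_algEquiv_of_almost_degenerate (M := M) (L := L) hγ t
  rw [eval_fibrePoly_eq_zero] at hρ
  refine ⟨algebraMap _ L (t - PowerSeries.X), by rw [← map_critIter, ht, Function.comp_apply],
    algebraMap _ L ρ, by rw [← map_eval_critPoly, ← map_add, hρ], fun u v hu hv huρ hvρ => ?_⟩
  rw [← aeval_fibrePoly_eq_zero] at hu hv
  obtain ⟨σ, hσ⟩ := hρ' u v hu hv huρ hvρ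
  exact ⟨σ, by rw [IsScalarTower.algebraMap_apply k⟦X⟧ M L, AlgEquiv.commutes], hσ⟩

end DegenerateMonodromy

section GenericFamilies

variable {K k : Type*} [Field K] [Field k] [Algebra K k] {r n : ℕ}

theorem isIntegral_adjoin_of_mem {N : Type*} [Field N] [Algebra K N] {s : Set N} {x : N}
    (hx : x ∈ s) : IsIntegral (IntermediateField.adjoin K s) x :=
  isIntegral_algebraMap (R := IntermediateField.adjoin K s)
    (x := ⟨x, IntermediateField.subset_adjoin K s hx⟩)

/-- The deformation of the constants `a` in the generic direction `c`. -/
noncomputable def perturbation (a : Fin r → K) (c : Fin r → k) (l : Fin r) : k⟦X⟧ :=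
  algebraMap K k⟦X⟧ (a l) + PowerSeries.C (c l) * PowerSeries.X

theorem constantCoeff_comp_perturbation (a : Fin r → K) (c : Fin r → k) :
    PowerSeries.constantCoeff ∘ perturbation a c = algebraMap K k ∘ a := by
  funext l
  simp [perturbation, PowerSeries.algebraMap_apply]

variable [Algebra ℚ k] {c : Fin r → k} (hc : AlgebraicIndependent K c)
include hc

theorem algebraicIndependent_perturbation {a : Fin r → K} {t : k⟦X⟧} {i : Fin r}
    (h : critIter (perturbation a c) t n (t - PowerSeries.X) = perturbation a c i) :
    AlgebraicIndependent K fun o : Option (Fin r) => o.elim t (perturbation a c) := by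
  let ι := algebraMap k⟦X⟧ (FractionRing k⟦X⟧)
  set N := IntermediateField.adjoin K
    (Set.range (ι ∘ fun o : Option (Fin r) => o.elim t (perturbation a c)))
  have hγ (l : Fin r) : IsIntegral N (ι (perturbation a c l)) :=
    isIntegral_adjoin_of_mem ⟨some l, rfl⟩
  have ht : IsIntegral N (ι t) := isIntegral_adjoin_of_mem ⟨none, rfl⟩
  have hX : IsIntegral N (ι PowerSeries.X) := by
    have hsub : IsIntegral N (ι (t - PowerSeries.X)) := by
      refine isIntegral_of_isIntegral_critIter (γ := ι ∘ perturbation a c) hγ ht (n := n) ?_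
      rw [← map_critIter, h]
      exact hγ i
    rw [← sub_sub_cancel t PowerSeries.X, map_sub]
    exact ht.sub hsub
  refine algebraicIndependent_of_isIntegral (FractionRing k⟦X⟧) hc hX fun l => ?_
  have ha : IsIntegral N (ι (algebraMap K k⟦X⟧ (a l))) := by
    rw [← IsScalarTower.algebraMap_apply, IsScalarTower.algebraMap_apply K N]
    exact isIntegral_algebraMap
  have hX0 : ι PowerSeries.X ≠ 0 :=
    (map_ne_zero_iff _ (IsFractionRing.injective _ _)).2 PowerSeries.X_ne_zero
  have hcl : ι (PowerSeries.C (c l)) =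
      (ι (perturbation a c l) - ι (algebraMap K k⟦X⟧ (a l))) * (ι PowerSeries.X)⁻¹ := by
    rw [perturbation, map_add, add_sub_cancel_left, map_mul, mul_inv_cancel_right₀ hX0]
  exact hcl ▸ ((hγ l).sub ha).mul hX.inv

theorem algebraicIndependent_add_X_C {τ : k} {j : Fin r}
    (h : critIter c τ (n + 1) (c j) = c j) :
    AlgebraicIndependent K fun o : Option (Fin r) =>
      o.elim (PowerSeries.C τ + PowerSeries.X) (PowerSeries.C ∘ c) := by
  let ι := algebraMap k⟦X⟧ (FractionRing k⟦X⟧)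
  set x : Option (Fin r) → k⟦X⟧ :=
    fun o => o.elim (PowerSeries.C τ + PowerSeries.X) (PowerSeries.C ∘ c)
  set N := IntermediateField.adjoin K (Set.range (ι ∘ x))
  have hτ : IsIntegral N (ι (PowerSeries.C τ)) := by
    have : CharZero (FractionRing k⟦X⟧) := algebraRat.charZero _
    have : CharZero N := (algebraMap N (FractionRing k⟦X⟧)).charZero
    let c' (l : Fin r) : N :=
      ⟨ι (PowerSeries.C (c l)), IntermediateField.subset_adjoin K _ ⟨some l, rfl⟩⟩
    refine ⟨relPoly c' n (c' j) (c' j), monic_relPoly j.pos _ _ _ _, ?_⟩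
    rw [← eval_map, map_relPoly, eval_relPoly, sub_eq_zero]
    have hι := congrArg (ι.comp PowerSeries.C) h
    rwa [map_critIter] at hι
  refine algebraicIndependent_of_isIntegral (FractionRing k⟦X⟧) hc ?_
    fun l => isIntegral_adjoin_of_mem ⟨some l, rfl⟩
  rw [← add_sub_cancel_left (PowerSeries.C τ) PowerSeries.X, map_sub]
  exact (isIntegral_adjoin_of_mem (s := Set.range (ι ∘ x)) ⟨none, rfl⟩).sub hτ

end GenericFamilies

section GenericMonodromy

variable {K B A : Type*} [Field K] [CharZero K] [Field B] [Algebra K B] [Field A] [Algebra B A]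
  [Algebra.IsAlgebraic B A] [IsAlgClosed A] [Algebra ℚ A] {r : ℕ} {γ : Fin r → B} {t : B}

theorem IsGeneric.galoisSwap (h : IsGeneric K γ t) (n : ℕ) (j : Fin r) :
    GaloisSwap B (algebraMap B A ∘ γ) (algebraMap B A t) n j := by
  obtain ⟨k, _, _, _, c, hc⟩ := exists_isAlgClosed_algebraicIndependent K r
  have : CharZero k := charZero_of_injective_algebraMap (algebraMap K k).injective
  obtain ⟨τ, hτ, hτ'⟩ := exists_hasUniqueCriticalRelation
    (hc.restrictScalars (algebraMap ℚ K).injective) n j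
  have hj : critIter c τ (n + 1) (c j) = c j := (hτ n le_rfl j j).2 ⟨rfl, rfl, rfl⟩
  let L := AlgebraicClosure (FractionRing k⟦X⟧)
  obtain ⟨ψ, hψγ, hψt, hψ⟩ :=
    h.exists_ringHom (A := A) (M := FractionRing k⟦X⟧) (L := L) (algebraicIndependent_add_X_C hc hj)
  refine .of_ringHom hψ ?_
  rw [hψγ, hψt]
  refine galoisSwap_of_hasUniqueCriticalRelation ?_ (not_X_sq_dvd_critIter_sub hj hτ')
  have hγ : PowerSeries.constantCoeff ∘ PowerSeries.C ∘ c = c :=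
    funext fun l => PowerSeries.constantCoeff_C _
  rwa [hγ, map_add, PowerSeries.constantCoeff_C, PowerSeries.constantCoeff_X, add_zero]

theorem IsGeneric.galoisTransitive (h : IsGeneric K γ t) (n : ℕ) (i : Fin r) :
    GaloisTransitive B (algebraMap B A ∘ γ) (algebraMap B A t) n i := by
  obtain ⟨k, _, _, _, c, hc⟩ := exists_isAlgClosed_algebraicIndependent K r
  have : CharZero k := charZero_of_injective_algebraMap (algebraMap K k).injective
  have hγ : PowerSeries.constantCoeff ∘ perturbation (0 : Fin r → K) c = 0 := by
    rw [constantCoeff_comp_perturbation]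
    exact funext fun _ => map_zero _
  obtain ⟨t', ht'⟩ := exists_param_of_degenerate (congrFun hγ i) n
  let L := AlgebraicClosure (FractionRing k⟦X⟧)
  obtain ⟨ψ, hψγ, hψt, hψ⟩ := h.exists_ringHom (A := A) (M := FractionRing k⟦X⟧) (L := L)
    (algebraicIndependent_perturbation hc ht')
  refine .of_ringHom hψ ?_
  rw [hψγ, hψt]
  exact galoisTransitive_of_totally_degenerate hγ ht'

theorem IsGeneric.galoisSiblings (h : IsGeneric K γ t) (n : ℕ) {i j : Fin r} (hij : i ≠ j) :
    GaloisSiblings B (algebraMap B A ∘ γ) (algebraMap B A t) n i := by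
  obtain ⟨k, _, _, _, c, hc⟩ := exists_isAlgClosed_algebraicIndependent K r
  have : CharZero k := charZero_of_injective_algebraMap (algebraMap K k).injective
  have hγ : PowerSeries.constantCoeff ∘ perturbation (Function.update (0 : Fin r → K) j r) c =
      Function.update (0 : Fin r → k) j r := by
    rw [constantCoeff_comp_perturbation, Function.comp_update, map_natCast]
    congr 1
    exact funext fun _ => map_zero _
  obtain ⟨t', ht'⟩ := exists_param_of_degenerate
    ((congrFun hγ i).trans (Function.update_of_ne hij _ _)) n
  let L := AlgebraicClosure (FractionRing k⟦X⟧)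
  obtain ⟨ψ, hψγ, hψt, hψ⟩ := h.exists_ringHom (A := A) (M := FractionRing k⟦X⟧) (L := L)
    (algebraicIndependent_perturbation hc ht')
  refine .of_ringHom hψ ?_
  rw [hψγ, hψt]
  exact galoisSiblings_of_almost_degenerate hγ ht'

end GenericMonodromy

/-! ### The forest of backward orbits of the critical points -/

theorem exists_labelling_fibre {A : Type*} [Field A] [Algebra ℚ A] [IsAlgClosed A] {r : ℕ}
    {γ : Fin r → A} {t x : A} (hx : ∀ i, (critPoly γ).eval (γ i) + t ≠ x) :
    ∃ e : Fin (r + 1) → A, Function.Injective e ∧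
      ∀ u, (critPoly γ).eval u + t = x ↔ u ∈ Set.range e := by
  classical
  have hcard : Fintype.card ((fibrePoly γ t x).rootSet A) = r + 1 := by
    rw [card_rootSet_eq_natDegree (separable_fibrePoly hx) (IsAlgClosed.splits _),
      natDegree_fibrePoly]
  let e := (Fintype.equivFinOfCardEq hcard).symm
  refine ⟨Subtype.val ∘ e, Subtype.val_injective.comp e.injective, fun u => ?_⟩
  rw [Set.range_comp, e.surjective.range_eq, Set.image_univ, Subtype.range_coe,
    mem_rootSet_of_ne (monic_fibrePoly γ t x).ne_zero, coe_aeval_eq_eval, eval_fibrePoly_eq_zero]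

theorem map_critIter_algebraMap {B A A' E : Type*} [CommRing B] [CommRing A] [CommRing A']
    [Algebra B A] [Algebra B A'] [Algebra ℚ A] [Algebra ℚ A'] [FunLike E A A']
    [AlgHomClass E B A A'] (σ : E) {r : ℕ} (γ : Fin r → B) (t : B) (n : ℕ) (x : A) :
    σ (critIter (algebraMap B A ∘ γ) (algebraMap B A t) n x) =
      critIter (algebraMap B A' ∘ γ) (algebraMap B A' t) n (σ x) := by
  have hγ : ⇑(σ : A →+* A') ∘ algebraMap B A ∘ γ = algebraMap B A' ∘ γ :=
    funext fun j => AlgHomClass.commutes σ (γ j)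
  have ht : (σ : A →+* A') (algebraMap B A t) = algebraMap B A' t := AlgHomClass.commutes σ t
  have h := map_critIter (σ : A →+* A') (algebraMap B A ∘ γ) (algebraMap B A t) n x
  rwa [hγ, ht] at h

section BackwardOrbit

variable {B A : Type*} [Field B] [Field A] [Algebra B A] [Algebra ℚ A] {r : ℕ}
  {γ : Fin r → B} {t : B}

variable (A γ t) in
/-- The points some iterate of which is a critical point. -/
noncomputable def backwardOrbit : SubMulAction Gal(A/B) A where
  carrier := {x | ∃ m i, critIter (algebraMap B A ∘ γ) (algebraMap B A t) m x =
    algebraMap B A (γ i)}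
  smul_mem' := by
    rintro σ x ⟨m, i, h⟩
    exact ⟨m, i, by rw [AlgEquiv.smul_def, ← map_critIter_algebraMap, h, AlgEquiv.commutes]⟩

variable [IsAlgClosed A] (hγ : Function.Injective γ)
  (hne : ∀ m i l, critIter (algebraMap B A ∘ γ) (algebraMap B A t) (m + 1)
    (algebraMap B A (γ i)) ≠ algebraMap B A (γ l))

include hne in
theorem exists_labelling_backwardOrbit (x : backwardOrbit A γ t) :
    ∃ e : Fin (r + 1) → backwardOrbit A γ t, Function.Injective e ∧
      ∀ u : A, (critPoly (algebraMap B A ∘ γ)).eval u + algebraMap B A t = x ↔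
        ∃ j, (e j : A) = u := by
  obtain ⟨x, m, l, hx⟩ := x
  obtain ⟨e, he, he'⟩ := exists_labelling_fibre (γ := algebraMap B A ∘ γ) (t := algebraMap B A t)
    (x := x) fun i h => hne m i l (by rw [critIter_succ, ← hx, ← h, Function.comp_apply])
  refine ⟨fun j => ⟨e j, m + 1, l, ?_⟩, fun a b h => he (congrArg Subtype.val h), he'⟩
  rw [critIter_succ, (he' _).2 ⟨j, rfl⟩, hx]

/-- The forest of iterated preimages of the critical points, for a polynomial without critical
relations. -/
noncomputable def backwardForest :
    RegularForest Gal(A/B) (backwardOrbit A γ t) (Fin r) (r + 1) where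
  root i := ⟨algebraMap B A (γ i), 0, i, rfl⟩
  child x := (exists_labelling_backwardOrbit hne x).choose
  root_injective i j h := hγ ((algebraMap B A).injective (congrArg Subtype.val h))
  smul_root σ i := Subtype.ext (σ.commutes (γ i))
  child_inj {x y i j} h := by
    have hx := (exists_labelling_backwardOrbit hne x).choose_spec
    have hy := (exists_labelling_backwardOrbit hne y).choose_spec
    obtain rfl : x = y :=
      Subtype.ext (((hx.2 _).2 ⟨i, congrArg Subtype.val h⟩).symm.trans ((hy.2 _).2 ⟨j, rfl⟩))
    exact ⟨rfl, hx.1 h⟩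
  exists_smul_child σ x i := by
    have hx := (exists_labelling_backwardOrbit hne x).choose_spec
    have hy := (exists_labelling_backwardOrbit hne (σ • x)).choose_spec
    obtain ⟨j, hj⟩ := (hy.2 (σ • ((exists_labelling_backwardOrbit hne x).choose i : A))).1
      ((map_critIter_algebraMap σ γ t 1 _).symm.trans (congrArg σ ((hx.2 _).2 ⟨i, rfl⟩)))
    exact ⟨j, Subtype.ext hj.symm⟩

theorem exists_child_backwardForest (x : backwardOrbit A γ t) (u : A) :
    (critPoly (algebraMap B A ∘ γ)).eval u + algebraMap B A t = x ↔
      ∃ j, ((backwardForest hγ hne).child x j : A) = u :=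
  (exists_labelling_backwardOrbit hne x).choose_spec.2 u

theorem eval_child_backwardForest (x : backwardOrbit A γ t) (j : Fin (r + 1)) :
    (critPoly (algebraMap B A ∘ γ)).eval ((backwardForest hγ hne).child x j : A) +
      algebraMap B A t = x :=
  (exists_child_backwardForest hγ hne x _).2 ⟨j, rfl⟩

theorem mem_level_backwardForest {i : Fin r} {n : ℕ} {x : backwardOrbit A γ t} :
    x ∈ (backwardForest hγ hne).level i n ↔
      critIter (algebraMap B A ∘ γ) (algebraMap B A t) n x = algebraMap B A (γ i) := by
  induction n generalizing x with
  | zero => exact Subtype.ext_iff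
  | succ n ih =>
    rw [critIter_succ]
    constructor
    · rintro ⟨y, hy, j, rfl⟩
      rw [eval_child_backwardForest]
      exact ih.1 hy
    · intro h
      let y : backwardOrbit A γ t :=
        ⟨(critPoly (algebraMap B A ∘ γ)).eval (x : A) + algebraMap B A t, n, i, h⟩
      obtain ⟨j, hj⟩ := (exists_child_backwardForest hγ hne y x).1 rfl
      exact ⟨y, ih.2 h, j, Subtype.ext hj⟩

variable {n : ℕ} {i : Fin r}

theorem childrenTransitive_backwardForest
    (h : GaloisTransitive B (algebraMap B A ∘ γ) (algebraMap B A t) n i) :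
    (backwardForest hγ hne).ChildrenTransitive n i := by
  obtain ⟨x, hx, h⟩ := h
  let x' : backwardOrbit A γ t := ⟨x, n, i, hx⟩
  refine ⟨x', (mem_level_backwardForest hγ hne).2 hx, fun a b => ?_⟩
  obtain ⟨σ, hσ⟩ := h _ _ (eval_child_backwardForest hγ hne x' a)
    (eval_child_backwardForest hγ hne x' b)
  exact ⟨σ, Subtype.ext hσ⟩

theorem siblingsTransitive_backwardForest
    (h : GaloisSiblings B (algebraMap B A ∘ γ) (algebraMap B A t) n i) :
    (backwardForest hγ hne).SiblingsTransitive n i := by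
  obtain ⟨x, hx, w, hw, h⟩ := h
  let x' : backwardOrbit A γ t := ⟨x, n, i, hx⟩
  obtain ⟨c, rfl⟩ := (exists_child_backwardForest hγ hne x' w).1 hw
  refine ⟨x', (mem_level_backwardForest hγ hne).2 hx, c, fun a b ha hb => ?_⟩
  obtain ⟨σ, hσ, hσ'⟩ := h _ _ (eval_child_backwardForest hγ hne x' a)
    (eval_child_backwardForest hγ hne x' b)
    (fun e => ha ((backwardForest hγ hne).child_inj (Subtype.ext e)).2)
    (fun e => hb ((backwardForest hγ hne).child_inj (Subtype.ext e)).2)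
  exact ⟨σ, Subtype.ext hσ, Subtype.ext hσ'⟩

theorem hasSiblingSwap_backwardForest
    (h : GaloisSwap B (algebraMap B A ∘ γ) (algebraMap B A t) n i) :
    (backwardForest hγ hne).HasSiblingSwap n i := by
  obtain ⟨u, v, huv, he, hu, σ, hσu, hσv, hfix⟩ := h
  let x : backwardOrbit A γ t :=
    ⟨(critPoly (algebraMap B A ∘ γ)).eval u + algebraMap B A t, n, i, hu⟩
  obtain ⟨a, ha⟩ := (exists_child_backwardForest hγ hne x u).1 rfl
  obtain ⟨b, hb⟩ := (exists_child_backwardForest hγ hne x v).1 (by rw [← he])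
  exact ⟨x, (mem_level_backwardForest hγ hne).2 hu, a, b,
    fun hab => huv (by rw [← ha, ← hb, hab]), σ,
    { smul_left := Subtype.ext (by rw [SubMulAction.val_smul, ha, hb]; exact hσu)
      smul_right := Subtype.ext (by rw [SubMulAction.val_smul, ha, hb]; exact hσv)
      smul_of_ne := fun l z hz hza hzb =>
        Subtype.ext (hfix l z ((mem_level_backwardForest hγ hne).1 hz)
          (fun e => hza (Subtype.ext (e.trans ha.symm)))
          fun e => hzb (Subtype.ext (e.trans hb.symm))) }⟩

end BackwardOrbit

theorem IsGeneric.critIter_ne {K B A : Type*} [Field K] [Field B] [Algebra K B] [Field A]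
    [Algebra B A] [Algebra ℚ A] {r : ℕ} {γ : Fin r → B} {t : B} (h : IsGeneric K γ t) (m : ℕ)
    (i l : Fin r) :
    critIter (algebraMap B A ∘ γ) (algebraMap B A t) (m + 1) (algebraMap B A (γ i)) ≠
      algebraMap B A (γ l) := by
  let _ : Algebra K A := ((algebraMap B A).comp (algebraMap K B)).toAlgebra
  have _ : IsScalarTower K B A := IsScalarTower.of_algebraMap_eq fun _ => rfl
  refine critIter_ne_of_algebraicIndependent (K := K) ?_ m i l
  have hind := h.algebraicIndependent.map' (f := IsScalarTower.toAlgHom K B A)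
    (algebraMap B A).injective
  convert hind with o
  cases o <;> rfl

section GenericWreath

variable {K B A : Type*} [Field K] [CharZero K] [Field B] [Algebra K B] [Field A] [Algebra B A]
  [Algebra.IsAlgebraic B A] [IsAlgClosed A] [Algebra ℚ A] {r : ℕ} {γ : Fin r → B} {t : B}

theorem IsGeneric.siblingsTransitive_backwardForest (h : IsGeneric K γ t)
    (hγ : Function.Injective γ)
    (hne : ∀ m i l, critIter (algebraMap B A ∘ γ) (algebraMap B A t) (m + 1)
      (algebraMap B A (γ i)) ≠ algebraMap B A (γ l)) (n : ℕ) (i : Fin r) :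
    (backwardForest hγ hne).SiblingsTransitive n i := by
  rcases subsingleton_or_nontrivial (Fin r) with hr | _
  · obtain ⟨x, hx, -⟩ := childrenTransitive_backwardForest hγ hne (h.galoisTransitive n i)
    rw [Fin.subsingleton_iff_le_one] at hr
    exact RegularForest.siblingsTransitive_of_le_two (by omega) hx
  · obtain ⟨j, hij⟩ := exists_ne i
    exact _root_.siblingsTransitive_backwardForest hγ hne (h.galoisSiblings n hij.symm)

theorem IsGeneric.exists_surjective_iteratedWreath (h : IsGeneric K γ t) (n : ℕ) :
    ∃ Θ : Gal(A/B) →* (Fin r → iteratedWreath (r + 1) n), Function.Surjective Θ ∧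
      ∀ σ, σ ∈ Θ.ker ↔ ∀ i x, critIter (algebraMap B A ∘ γ) (algebraMap B A t) n x =
        algebraMap B A (γ i) → σ x = x := by
  have hγ : Function.Injective γ :=
    fun _ _ e => Option.some_injective _ (h.algebraicIndependent.injective e)
  let T := backwardForest hγ (h.critIter_ne (A := A))
  refine ⟨T.portraitHom n, T.portraitHom_surjective
    (fun m i => childrenTransitive_backwardForest hγ _ (h.galoisTransitive m i))
    (fun m i => h.siblingsTransitive_backwardForest hγ _ m i)
    (fun m i => hasSiblingSwap_backwardForest hγ _ (h.galoisSwap m i)) n, fun σ => ?_⟩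
  rw [T.mem_ker_portraitHom]
  refine forall_congr' fun i => ⟨fun H x hx => ?_, fun H z hz => ?_⟩
  · exact congrArg Subtype.val (H ⟨x, n, i, hx⟩ ((mem_level_backwardForest hγ _).2 hx))
  · exact Subtype.ext (H z ((mem_level_backwardForest hγ _).1 hz))

end GenericWreath

/-! ### The generic monic polynomial -/

theorem isGalois_adjoin_of_ker_eq {B A G : Type*} [Field B] [Field A] [Algebra B A] [IsGalois B A]
    [Group G] {S : Set A} (hS : ∀ σ : Gal(A/B), ∀ x ∈ S, σ x ∈ S) (Θ : Gal(A/B) →* G)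
    (hΘ : Function.Surjective Θ) (hker : ∀ σ, σ ∈ Θ.ker ↔ ∀ x ∈ S, σ x = x) :
    IsGalois B (IntermediateField.adjoin B S) ∧
      Nonempty (Gal(IntermediateField.adjoin B S/B) ≃* G) := by
  have _ : Normal B (IntermediateField.adjoin B S) := by
    refine IntermediateField.normal_iff_forall_map_le'.2 fun σ => ?_
    rw [IntermediateField.adjoin_map, IntermediateField.adjoin_le_iff]
    rintro _ ⟨x, hx, rfl⟩
    exact IntermediateField.subset_adjoin _ _ (hS σ x hx)
  have hker_eq :
      (AlgEquiv.restrictNormalHom (F := B) (K₁ := A) (IntermediateField.adjoin B S)).ker =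
        Θ.ker := by
    ext σ
    rw [IntermediateField.restrictNormalHom_ker, IntermediateField.mem_fixingSubgroup_iff, hker]
    exact IntermediateField.forall_mem_adjoin_smul_eq_self_iff B σ
  exact ⟨⟨⟩, ⟨(QuotientGroup.quotientKerEquivOfSurjective _
    (AlgEquiv.restrictNormalHom_surjective A)).symm.trans
      ((QuotientGroup.quotientMulEquivOfEq hker_eq).trans
        (QuotientGroup.quotientKerEquivOfSurjective _ hΘ))⟩⟩

theorem exists_eq_C_mul_prod_X_sub_C {E : Type*} [Field E] {p : E[X]} (hp : p.Splits) {r : ℕ}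
    (hr : p.natDegree = r) : ∃ γ : Fin r → E, p = C p.leadingCoeff * ∏ j, (X - C (γ j)) := by
  classical
  let e := Fintype.equivFinOfCardEq
    ((Multiset.card_coe p.roots).trans (hp.natDegree_eq_card_roots.symm.trans hr))
  refine ⟨fun j => (e.symm j).1, ?_⟩
  conv_lhs => rw [hp.eq_prod_roots]
  rw [e.symm.prod_comp fun x : p.roots => X - C x.1, Finset.prod_eq_multiset_prod,
    Multiset.map_univ p.roots fun x => X - C x]

theorem exists_eq_critPoly_add_C {E : Type*} [Field E] [Algebra ℚ E] {r : ℕ} {p : E[X]}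
    (hp : p.Monic) (hr : p.natDegree = r + 1) (hs : (derivative p).Splits) :
    ∃ γ : Fin r → E, p = critPoly γ + C (p.coeff 0) := by
  have _ : CharZero E := algebraRat.charZero E
  have hcoeff : (derivative p).coeff r = r + 1 := by
    rw [coeff_derivative, ← hr, hp.coeff_natDegree, one_mul]
  have hdeg : (derivative p).natDegree = r :=
    natDegree_eq_of_le_of_coeff_ne_zero ((natDegree_derivative_le p).trans (by omega)) <| by
      rw [hcoeff]
      exact_mod_cast r.succ_ne_zero
  obtain ⟨γ, hγ⟩ := exists_eq_C_mul_prod_X_sub_C hs hdeg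
  rw [leadingCoeff, hdeg, hcoeff] at hγ
  refine ⟨γ, eq_of_derivative_eq_of_coeff_zero_eq ?_ ?_⟩
  · rw [derivative_add, derivative_C, add_zero, derivative_critPoly]
    exact hγ
  · rw [coeff_add, coeff_C_zero, coeff_zero_eq_eval_zero (critPoly _), eval_zero_critPoly, zero_add]

theorem coeff_critPoly_mem {K E : Type*} [Field K] [Field E] [Algebra K E] [Algebra ℚ E] {r : ℕ}
    (N : IntermediateField K E) {γ : Fin r → E} (hγ : ∀ j, γ j ∈ N) (k : ℕ) :
    (critPoly γ).coeff k ∈ N := by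
  have _ : CharZero E := algebraRat.charZero E
  have _ : CharZero N := (algebraMap N E).charZero_iff (algebraMap N E).injective |>.2 ‹_›
  have h := map_critPoly (algebraMap N E) fun j => (⟨γ j, hγ j⟩ : N)
  rw [show ⇑(algebraMap N E) ∘ (fun j => (⟨γ j, hγ j⟩ : N)) = γ from rfl] at h
  rw [← h, coeff_map]
  exact SetLike.coe_mem _

section MonicPoly

variable {F : Type*} [Field F] {r : ℕ} (s : Fin r → F) (t : F)

theorem degree_sum_add_C_lt :
    (∑ i : Fin r, C (s i) * X ^ (r + 1 - (i.val + 1)) + C t).degree < (r + 1 : ℕ) := by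
  refine (degree_add_le _ _).trans_lt (max_lt ?_ ?_)
  · refine (degree_sum_le _ _).trans_lt ((Finset.sup_lt_iff (WithBot.bot_lt_coe _)).2 fun i _ => ?_)
    refine (degree_C_mul_X_pow_le _ _).trans_lt ?_
    exact_mod_cast (by omega : r + 1 - (i.val + 1) < r + 1)
  · exact degree_C_le.trans_lt (by exact_mod_cast r.succ_pos)

theorem monic_monicPoly : (monicPoly (r + 1) s t).Monic := by
  rw [monicPoly, add_assoc]
  exact monic_X_pow_add (degree_sum_add_C_lt s t)

theorem natDegree_monicPoly : (monicPoly (r + 1) s t).natDegree = r + 1 := by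
  rw [monicPoly, add_assoc, natDegree_add_eq_left_of_degree_lt, natDegree_X_pow]
  rw [degree_X_pow]
  exact degree_sum_add_C_lt s t

theorem coeff_zero_monicPoly : (monicPoly (r + 1) s t).coeff 0 = t := by
  rw [monicPoly, coeff_add, coeff_add, coeff_C_zero, coeff_X_pow, finsetSum_coeff,
    Finset.sum_eq_zero fun i _ => ?_]
  · simp
  · rw [coeff_C_mul_X_pow, if_neg (by have := i.isLt; omega)]

theorem coeff_monicPoly (i : Fin r) : (monicPoly (r + 1) s t).coeff (r - i) = s i := by
  have hi := i.isLt
  rw [monicPoly, coeff_add, coeff_add, coeff_X_pow, if_neg (by omega), coeff_C,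
    if_neg (by omega), finsetSum_coeff, Finset.sum_eq_single (M := F) (ι := Fin (r + 1 - 1)) i]
  · rw [coeff_C_mul_X_pow, if_pos (by omega), zero_add, add_zero]
  · intro j _ hj
    have _ := j.isLt
    rw [coeff_C_mul_X_pow, if_neg fun h => hj (Fin.ext (by omega))]
  · exact fun h => absurd (Finset.mem_univ _) h

variable {s t} {K E : Type*} [Field K] [Algebra K F] [Field E] [Algebra F E] [Algebra K E]
  [IsScalarTower K F E] [Algebra ℚ E]

theorem isGeneric_of_map_monicPoly_eq {γ : Fin r → E}
    (hγ : (monicPoly (r + 1) s t).map (algebraMap F E) = critPoly γ + C (algebraMap F E t))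
    (hγtop : IntermediateField.adjoin F (Set.range γ) = ⊤)
    (hindep : AlgebraicIndependent K (fun o : Option (Fin r) => o.elim t s))
    (hgen : IntermediateField.adjoin K (insert t (Set.range s)) = ⊤) :
    IsGeneric K γ (algebraMap F E t) := by
  set N := IntermediateField.adjoin K
    (Set.range fun o : Option (Fin r) => o.elim (algebraMap F E t) γ) with hN
  have htN : algebraMap F E t ∈ N := IntermediateField.subset_adjoin _ _ ⟨none, rfl⟩
  have hγN (j : Fin r) : γ j ∈ N := IntermediateField.subset_adjoin _ _ ⟨some j, rfl⟩
  have hsN (i : Fin r) : algebraMap F E (s i) ∈ N := by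
    have hi := i.isLt
    rw [← coeff_monicPoly s t, ← coeff_map, hγ, coeff_add, coeff_C, if_neg (by omega), add_zero]
    exact coeff_critPoly_mem N hγN _
  have hFN (a : F) : algebraMap F E a ∈ N := by
    have hle : IntermediateField.adjoin K (insert t (Set.range s)) ≤
        N.comap (IsScalarTower.toAlgHom K F E) := by
      rw [IntermediateField.adjoin_le_iff, Set.insert_subset_iff, Set.range_subset_iff]
      exact ⟨htN, hsN⟩
    exact hle (hgen ▸ IntermediateField.mem_top)
  constructor
  · have hindep' := hindep.map' (f := IsScalarTower.toAlgHom K F E) (algebraMap F E).injective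
    refine algebraicIndependent_of_isAlgebraic_adjoin hindep' fun o => ?_
    cases o with
    | none => exact isAlgebraic_algebraMap (⟨_, htN⟩ : N)
    | some i => exact isAlgebraic_algebraMap (⟨_, hsN i⟩ : N)
  · have hle : IntermediateField.adjoin F (Set.range γ) ≤ N.toSubfield.toIntermediateField hFN :=
      IntermediateField.adjoin_le_iff.2 (Set.range_subset_iff.2 hγN)
    rw [← hN, eq_top_iff]
    exact fun x _ => hle (hγtop ▸ IntermediateField.mem_top)

theorem exists_isGeneric_of_isSplittingField
    [hs : IsSplittingField F E (derivative (monicPoly (r + 1) s t))]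
    (hindep : AlgebraicIndependent K (fun o : Option (Fin r) => o.elim t s))
    (hgen : IntermediateField.adjoin K (insert t (Set.range s)) = ⊤) :
    ∃ γ : Fin r → E,
      (monicPoly (r + 1) s t).map (algebraMap F E) = critPoly γ + C (algebraMap F E t) ∧
      IsGeneric K γ (algebraMap F E t) := by
  obtain ⟨γ, hγ⟩ := exists_eq_critPoly_add_C ((monic_monicPoly s t).map (algebraMap F E))
    (by rw [(monic_monicPoly s t).natDegree_map, natDegree_monicPoly])
    (by rw [derivative_map]; exact hs.splits)
  rw [coeff_map, coeff_zero_monicPoly] at hγ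
  refine ⟨γ, hγ, isGeneric_of_map_monicPoly_eq hγ ?_ hindep hgen⟩
  have hroots : (derivative (monicPoly (r + 1) s t)).rootSet E ⊆ Set.range γ := fun x hx => by
    have hx' := aeval_eq_zero_of_mem_rootSet hx
    rw [← eval_map_algebraMap, ← derivative_map, hγ, derivative_add, derivative_C, add_zero] at hx'
    obtain ⟨i, rfl⟩ := exists_eq_of_eval_derivative_critPoly hx'
    exact ⟨i, rfl⟩
  rw [← IntermediateField.toSubalgebra_inj, IntermediateField.top_toSubalgebra, eq_top_iff,
    ← hs.adjoin_rootSet]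
  exact Algebra.adjoin_le (hroots.trans (IntermediateField.subset_adjoin F _))

end MonicPoly

section PreimageField

theorem iUnion_iteratedPreimage_eq {F E Ω : Type*} [Field F] [Field E] [Field Ω] [Algebra F E]
    [Algebra F Ω] [Algebra E Ω] [IsScalarTower F E Ω] [Algebra ℚ E] [Algebra ℚ Ω] {f : F[X]} {r : ℕ}
    {γ : Fin r → E} {t : E} (hf : f.map (algebraMap F E) = critPoly γ + C t) (n : ℕ) :
    (⋃ β ∈ criticalPoints Ω f, iteratedPreimage f n β) =
      {x | ∃ i, critIter (algebraMap E Ω ∘ γ) (algebraMap E Ω t) n x = algebraMap E Ω (γ i)} := by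
  have hfΩ : f.map (algebraMap F Ω) = critPoly (algebraMap E Ω ∘ γ) + C (algebraMap E Ω t) := by
    rw [IsScalarTower.algebraMap_eq F E Ω, ← Polynomial.map_map, hf, Polynomial.map_add,
      map_critPoly, map_C]
  have haeval : (fun y : Ω => aeval y f) =
      fun y => (critPoly (algebraMap E Ω ∘ γ)).eval y + algebraMap E Ω t := by
    funext y
    rw [← eval_map_algebraMap, hfΩ, eval_add, eval_C]
  have hcrit (y : Ω) : y ∈ criticalPoints Ω f ↔ ∃ i, y = algebraMap E Ω (γ i) := by
    change aeval y (derivative f) = 0 ↔ _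
    rw [← eval_map_algebraMap, ← derivative_map, hfΩ, derivative_add, derivative_C, add_zero]
    exact ⟨exists_eq_of_eval_derivative_critPoly,
      fun ⟨i, hi⟩ => hi ▸ eval_derivative_critPoly_self (algebraMap E Ω ∘ γ) i⟩
  ext x
  simp only [Set.mem_iUnion, hcrit, iteratedPreimage, haeval, Set.mem_ofPred_eq, exists_prop]
  exact exists_eq_right'

theorem image_setOf_critIter_eq {B A Ω : Type*} [Field B] [Field A] [Field Ω] [Algebra B A]
    [Algebra B Ω] [IsAlgClosed A] [Algebra ℚ A] [Algebra ℚ Ω] {r : ℕ} {γ : Fin r → B} {t : B}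
    (ψ : A →ₐ[B] Ω) (n : ℕ) :
    ψ '' {x | ∃ i, critIter (algebraMap B A ∘ γ) (algebraMap B A t) n x = algebraMap B A (γ i)} =
      {x | ∃ i, critIter (algebraMap B Ω ∘ γ) (algebraMap B Ω t) n x = algebraMap B Ω (γ i)} := by
  ext y
  constructor
  · rintro ⟨x, ⟨i, hx⟩, rfl⟩
    exact ⟨i, by rw [← map_critIter_algebraMap, hx, AlgHom.commutes]⟩
  · rintro ⟨i, hy⟩
    obtain ⟨x, hx, hx'⟩ := exists_preimage_of_critIter (ψ : A →+* Ω) (γ := algebraMap B A ∘ γ)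
      (t := algebraMap B A t) (x := algebraMap B A (γ i)) (n := n) (y := y)
      (by simpa [Function.comp_def] using hy)
    exact ⟨x, ⟨i, hx'⟩, hx⟩

variable {F Ω : Type*} [Field F] [Field Ω] [Algebra F Ω] [IsAlgClosed Ω] {f : F[X]}

theorem criticalField_le_preimageField (hf : f.Monic) (hd : f.natDegree ≠ 0) (n : ℕ) :
    criticalField Ω f ≤ preimageField Ω f n := by
  have hsurj : Function.Surjective fun y : Ω => aeval y f := by
    simp only [← eval_map_algebraMap]
    exact IsAlgClosed.eval_surjective (by rwa [hf.natDegree_map])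
  have hmaps : Set.MapsTo (fun y : Ω => aeval y f) (preimageField Ω f n) (preimageField Ω f n) :=
    fun x hx => by
      have hmem := SetLike.coe_mem (aeval (⟨x, hx⟩ : preimageField Ω f n) f)
      rwa [← IntermediateField.aeval_coe] at hmem
  refine IntermediateField.adjoin_le_iff.2 fun β hβ => ?_
  obtain ⟨x, rfl⟩ := hsurj.iterate n β
  exact hmaps.iterate n (IntermediateField.subset_adjoin _ _ (Set.mem_biUnion hβ rfl))

theorem isSplittingField_criticalField (hf : derivative f ≠ 0) :
    IsSplittingField F (criticalField Ω f) (derivative f) := by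
  have hroots : criticalPoints Ω f = (derivative f).rootSet Ω :=
    Set.ext fun x => (mem_rootSet_of_ne hf).symm
  rw [criticalField, hroots]
  exact IntermediateField.adjoin_rootSet_isSplittingField (IsAlgClosed.splits _)

variable {K B : Type*} [Field K] [CharZero K] [Field B] [Algebra K B] [Algebra B Ω] [Algebra ℚ Ω]
  {r : ℕ} {γ : Fin r → B} {t : B}

theorem IsGeneric.isGalois_adjoin_critIter (h : IsGeneric K γ t) {n : ℕ} {S : Set Ω}
    (hS : S = {x | ∃ i, critIter (algebraMap B Ω ∘ γ) (algebraMap B Ω t) n x =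
      algebraMap B Ω (γ i)}) :
    IsGalois B (IntermediateField.adjoin B S) ∧
      Nonempty (Gal(IntermediateField.adjoin B S/B) ≃* (Fin r → iteratedWreath (r + 1) n)) := by
  let A := AlgebraicClosure B
  have _ : CharZero B := charZero_of_injective_algebraMap (algebraMap K B).injective
  have _ : CharZero A := charZero_of_injective_algebraMap (algebraMap B A).injective
  obtain ⟨Θ, hΘ, hker⟩ := h.exists_surjective_iteratedWreath (A := A) n
  let S' : Set A :=
    {x | ∃ i, critIter (algebraMap B A ∘ γ) (algebraMap B A t) n x = algebraMap B A (γ i)}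
  obtain ⟨_, ⟨e⟩⟩ := isGalois_adjoin_of_ker_eq (S := S')
    (fun σ x ⟨i, hx⟩ => ⟨i, by rw [← map_critIter_algebraMap, hx, AlgEquiv.commutes]⟩) Θ hΘ
    fun σ => (hker σ).trans ⟨fun H x ⟨i, hx⟩ => H i x hx, fun H i x hx => H x ⟨i, hx⟩⟩
  let ψ : A →ₐ[B] Ω := IsAlgClosed.lift
  have hmap : (IntermediateField.adjoin B S').map ψ = IntermediateField.adjoin B S := by
    rw [IntermediateField.adjoin_map, image_setOf_critIter_eq, hS]
  let e' := ((IntermediateField.adjoin B S').equivMap ψ).trans (IntermediateField.equivOfEq hmap)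
  exact ⟨.of_algEquiv e', ⟨(AlgEquiv.autCongr e').symm.trans e⟩⟩

end PreimageField

theorem proposition1p2_general {K : Type*} [Field K] [CharZero K] (d : ℕ) (hd : d ≠ 0) (n : ℕ)
    {F : Type*} [Field F] [Algebra K F] (s : Fin (d - 1) → F) (t : F)
    (hindep : AlgebraicIndependent K (fun o : Option (Fin (d - 1)) => o.elim t s))
    (hgen : IntermediateField.adjoin K (insert t (Set.range s)) = ⊤)
    (Ω : Type*) [Field Ω] [Algebra F Ω] [IsAlgClosed Ω] :
    ∃ h : criticalField Ω (monicPoly d s t) ≤ preimageField Ω (monicPoly d s t) n,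
      IsGalois (criticalField Ω (monicPoly d s t)) (IntermediateField.extendScalars h) ∧
      Nonempty (Gal(IntermediateField.extendScalars h / criticalField Ω (monicPoly d s t)) ≃*
        (Fin (d - 1) → iteratedWreath d n)) := by
  obtain ⟨r, rfl⟩ := Nat.exists_eq_succ_of_ne_zero hd
  let _ : Algebra K Ω := ((algebraMap F Ω).comp (algebraMap K F)).toAlgebra
  have _ : IsScalarTower K F Ω := IsScalarTower.of_algebraMap_eq fun _ => rfl
  have _ : CharZero F := charZero_of_injective_algebraMap (algebraMap K F).injective
  have _ : CharZero Ω := charZero_of_injective_algebraMap (algebraMap K Ω).injective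
  have hdeg := natDegree_monicPoly (r := r) s t
  have h := criticalField_le_preimageField (Ω := Ω) (monic_monicPoly (r := r) s t) (by omega) n
  have hsplit := isSplittingField_criticalField (Ω := Ω) (f := monicPoly (r + 1) s t)
    (derivative_eq_zero.not.2 (by omega))
  have _ : CharZero (criticalField Ω (monicPoly (r + 1) s t)) :=
    charZero_of_injective_algebraMap (algebraMap F _).injective
  obtain ⟨γ, hγ, hgeneric⟩ := exists_isGeneric_of_isSplittingField
    (E := criticalField Ω (monicPoly (r + 1) s t)) (r := r) hindep hgen
  have hGal := hgeneric.isGalois_adjoin_critIter (iUnion_iteratedPreimage_eq (Ω := Ω) hγ n)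
  rw [← IntermediateField.extendScalars_adjoin h] at hGal
  exact ⟨h, hGal⟩

theorem proposition1p2 {K : Type*} [Field K] [NumberField K] (d : ℕ) (hd : 2 ≤ d) (n : ℕ)
    {F : Type*} [Field F] [Algebra K F] (s : Fin (d - 1) → F) (t : F)
    (hindep : AlgebraicIndependent K (fun o : Option (Fin (d - 1)) => o.elim t s))
    (hgen : IntermediateField.adjoin K (insert t (Set.range s)) = ⊤)
    (Ω : Type*) [Field Ω] [Algebra F Ω] [IsAlgClosed Ω] :
    ∃ h : criticalField Ω (monicPoly d s t) ≤ preimageField Ω (monicPoly d s t) n,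
      IsGalois (criticalField Ω (monicPoly d s t)) (IntermediateField.extendScalars h) ∧
      Nonempty (Gal(IntermediateField.extendScalars h / criticalField Ω (monicPoly d s t)) ≃*
        (Fin (d - 1) → iteratedWreath d n)) :=
  proposition1p2_general d (by omega) n s t hindep hgen Ω
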